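/- Fix $T>0$ and let $A\in\mathcal C^1(\mathbb R\times\mathbb R^3;\mathbb R^3)$, $(t,x)\mapsto A(t,x)$, be $T$-periodic in $t$, i.e. $A(t+T,x)=A(t,x)$ for all $(t,x)$, with $\partial_tA\not\equiv 0$, and such that $$\lim_{|x|\to\infty}\big(|\partial_tA(t,x)|+|\nabla A(t,x)|\big)=0\quad\text{uniformly in }t\in\mathbb R,$$ where $\nabla A$ denotes the spatial Jacobian matrix of $A$. Consider the Lorentz force equation with vector potential $A$ and zero scalar potential, $$\frac{d}{dt}\left(\frac{\dot q(t)}{\sqrt{1-|\dot q(t)|^2}}\right)=-\partial_tA(t,q(t))+\dot q(t)\times(\nabla\times A)(t,q(t)),\qquad(\ast)$$ where $\nabla\times$ is the curl in the spatial variables. A $T$-periodic solution of $(\ast)$ is a $T$-periodic function $q\in\mathcal C^2(\mathbb R;\mathbb R^3)$ with $\|\dot q\|_\infty=\sup_{t}|\dot q(t)|<1$ that satisfies $(\ast)$ for all $t\in\mathbb R$. Then $(\ast)$ has at least one non-constant $T$-periodic solution. Moreover, there is a constant $\rho\in(0,1)$, depending only on $A$ and $T$, such that $\|\dot q\|_\infty<\rho$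 for every $T$-periodic solution $q$ of $(\ast)$. -/

import Mathlib

open scoped ContDiff Topology Matrix

/-- Physical space `ℝ³` with its Euclidean norm. -/
abbrev E3 : Type := EuclideanSpace ℝ (Fin 3)

noncomputable section

/-- The cross product `u × v` on `ℝ³`. -/
def cross3 (u v : E3) : E3 :=
  WithLp.toLp 2 (crossProduct (WithLp.ofLp u) (WithLp.ofLp v))

/-- The partial derivative `∂ⱼ Fᵢ (x)` of the `i`-th component of a vector field on `ℝ³`. -/
def partialComp (F : E3 → E3) (x : E3) (j i : Fin 3) : ℝ :=
  (fderiv ℝ F x (EuclideanSpace.single j 1)) i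

/-- The curl `(∇ × F)(x)` of a vector field on `ℝ³`. -/
def curl3 (F : E3 → E3) (x : E3) : E3 :=
  !₂[partialComp F x 1 2 - partialComp F x 2 1,
     partialComp F x 2 0 - partialComp F x 0 2,
     partialComp F x 0 1 - partialComp F x 1 0]

/-- The time derivative `∂ₜ A (t, x)` of a time-dependent vector field. -/
def timeDeriv (A : ℝ → E3 → E3) (t : ℝ) (x : E3) : E3 :=
  deriv (fun s => A s x) t

/-- The field `E = -∂ₜ A` generated by the vector potential `A` (and zero scalar potential). -/
def electricField (A : ℝ → E3 → E3) (t : ℝ) (x : E3) : E3 :=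
  -timeDeriv A t x

/-- The field `B = ∇ × A` generated by the vector potential `A`. -/
def magneticField (A : ℝ → E3 → E3) (t : ℝ) (x : E3) : E3 :=
  curl3 (A t) x

/-- The relativistic momentum `q̇(t) / √(1 - |q̇(t)|²)`. -/
def relMomentum (q : ℝ → E3) (t : ℝ) : E3 :=
  (Real.sqrt (1 - ‖deriv q t‖ ^ 2))⁻¹ • deriv q t

/-- The supremum norm `‖q̇‖_∞` of the velocity, as an extended non-negative real. -/
def velocitySup (q : ℝ → E3) : ENNReal :=
  ⨆ t : ℝ, ‖deriv q t‖ₑ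

/-- `q` is a `T`-periodic solution of the Lorentz force equation with vector potential `A` and
zero scalar potential: a `T`-periodic `C²` curve with `‖q̇‖_∞ < 1` that satisfies the equation
at every time. -/
structure IsPeriodicLFESolution (T : ℝ) (A : ℝ → E3 → E3) (q : ℝ → E3) : Prop where
  contDiff : ContDiff ℝ 2 q
  periodic : Function.Periodic q T
  subluminal : velocitySup q < 1
  equation : ∀ t : ℝ, HasDerivAt (relMomentum q)
    (electricField A t (q t) + cross3 (deriv q t) (magneticField A t (q t))) t

end

/-! Periodic solutions are critical points of the action `∫ (1 - √(1 - |q̇|²)) + A(t, q) · q̇` on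
closed curves of speed at most one, and a minimizer is constructed. The circulation term sees only
the oscillation of `A` along the curve, because a constant potential integrates to zero. A curve of
speed at most one stays within distance `T` of its starting point, so by decay the action of a curve
starting far away is almost nonnegative. On the other hand `A(·, c)` is non-constant for some `c`;
with `u` its oscillating part, the small loop with velocity `-εu` gains `ε ∫ |u|²` at a cost of
order `ε²`, so the infimum is negative. Minimizers therefore start in a bounded region and are not
constant.

The minimization is done on closed polygons with `n` edges, a finite-dimensional compact problem
(`exists_isDiscreteOrbit`). Minimizers are strictly slower than light (`step_lt_of_isMinOn`) and
satisfy a discrete Euler-Lagrange equation (`momOfVel_succ_sub_of_isMinOn`). Their momenta are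
bounded above uniformly in `n`, and the negative action forces some momentum to stay away from zero.
Both bounds survive the limit `n → ∞` (`exists_isPeriodicLFESolution_of_isDiscreteOrbit`), which
yields a non-constant solution.

The speed bound is a turn-around argument (`norm_momentum_le_of_periodic`): the force is at most
`3M`, so a momentum above `3MT` would keep the particle moving to one side for a whole period.
Bounded momentum means speed bounded away from one. -/

noncomputable section

/-! ### Relativistic velocity and momentum. -/

section Kinematics

variable {E : Type*} [NormedAddCommGroup E] [InnerProductSpace ℝ E]

/-- The velocity of a relativistic particle of momentum `p`. -/
def velOfMom (p : E) : E := (Real.sqrt (1 + ‖p‖ ^ 2))⁻¹ • p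

/-- The momentum of a relativistic particle of velocity `v`. -/
def momOfVel (v : E) : E := (Real.sqrt (1 - ‖v‖ ^ 2))⁻¹ • v

lemma norm_velOfMom (p : E) : ‖velOfMom p‖ = ‖p‖ / Real.sqrt (1 + ‖p‖ ^ 2) := by
  rw [velOfMom, norm_smul, norm_inv, Real.norm_of_nonneg (Real.sqrt_nonneg _), div_eq_inv_mul]

lemma norm_velOfMom_sq (p : E) : ‖velOfMom p‖ ^ 2 = ‖p‖ ^ 2 / (1 + ‖p‖ ^ 2) := by
  rw [norm_velOfMom, div_pow, Real.sq_sqrt (by positivity)]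

lemma norm_velOfMom_le_of_norm_le {p : E} {b : ℝ} (hp : ‖p‖ ≤ b) :
    ‖velOfMom p‖ ≤ b / Real.sqrt (1 + b ^ 2) := by
  have hb : 0 ≤ b := (norm_nonneg p).trans hp
  refine abs_le_of_sq_le_sq' ?_ (by positivity) |>.2
  rw [norm_velOfMom_sq, div_pow, Real.sq_sqrt (by positivity),
    div_le_div_iff₀ (by positivity) (by positivity)]
  nlinarith [pow_le_pow_left₀ (norm_nonneg p) hp 2]

lemma div_sqrt_one_add_sq_lt_one (b : ℝ) : b / Real.sqrt (1 + b ^ 2) < 1 := by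
  rw [div_lt_one (by positivity)]
  exact Real.lt_sqrt_of_sq_lt (by linarith)

lemma norm_velOfMom_lt_one (p : E) : ‖velOfMom p‖ < 1 :=
  (norm_velOfMom_le_of_norm_le le_rfl).trans_lt (div_sqrt_one_add_sq_lt_one _)

lemma momOfVel_velOfMom (p : E) : momOfVel (velOfMom p) = p := by
  have h1 : (0 : ℝ) < 1 + ‖p‖ ^ 2 := by positivity
  have h2 : 1 - ‖velOfMom p‖ ^ 2 = (1 + ‖p‖ ^ 2)⁻¹ := by
    rw [norm_velOfMom_sq]; field_simp; ring
  rw [momOfVel, h2, velOfMom, smul_smul, Real.sqrt_inv, inv_inv, mul_inv_cancel₀, one_smul]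
  positivity

lemma velOfMom_momOfVel {v : E} (hv : ‖v‖ < 1) : velOfMom (momOfVel v) = v := by
  have h1 : (0 : ℝ) < 1 - ‖v‖ ^ 2 := by nlinarith [norm_nonneg v]
  have h2 : 1 + ‖momOfVel v‖ ^ 2 = (1 - ‖v‖ ^ 2)⁻¹ := by
    rw [momOfVel, norm_smul, mul_pow, norm_inv, Real.norm_of_nonneg (Real.sqrt_nonneg _), inv_pow,
      Real.sq_sqrt h1.le]
    field_simp; ring
  rw [velOfMom, h2, momOfVel, smul_smul, Real.sqrt_inv, inv_inv, mul_inv_cancel₀, one_smul]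
  positivity

lemma contDiff_velOfMom {n : WithTop ℕ∞} : ContDiff ℝ n (velOfMom : E → E) := by
  have h : ContDiff ℝ n (fun p : E => 1 + ‖p‖ ^ 2) := contDiff_const.add (contDiff_norm_sq ℝ)
  have hpos (p : E) : 1 + ‖p‖ ^ 2 ≠ 0 := by positivity
  exact ((h.sqrt hpos).inv fun p => by positivity).smul contDiff_id

lemma inner_velOfMom_pos {p z : E} (h : 0 < inner ℝ p z) : 0 < inner ℝ (velOfMom p) z := by
  rw [velOfMom, real_inner_smul_left]
  positivity

lemma norm_le_norm_momOfVel {v : E} (hv : ‖v‖ < 1) : ‖v‖ ≤ ‖momOfVel v‖ := by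
  have h1 : (0 : ℝ) < 1 - ‖v‖ ^ 2 := by nlinarith [norm_nonneg v]
  rw [momOfVel, norm_smul, norm_inv, Real.norm_of_nonneg (Real.sqrt_nonneg _)]
  refine le_mul_of_one_le_left (norm_nonneg v) ((one_le_inv₀ (by positivity)).2 ?_)
  exact Real.sqrt_le_one.2 (by nlinarith [norm_nonneg v])

/-- The momentum is the gradient of the kinetic Lagrangian `1 - √(1 - |v|²)`. -/
lemma hasDerivAt_one_sub_sqrt {v u : E} (hv : ‖v‖ < 1) :
    HasDerivAt (fun s : ℝ => 1 - Real.sqrt (1 - ‖v + s • u‖ ^ 2))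
      (inner ℝ (momOfVel v) u) 0 := by
  have h1 : (0 : ℝ) < 1 - ‖v‖ ^ 2 := by nlinarith [norm_nonneg v]
  have h2 : HasDerivAt (fun s : ℝ => v + s • u) u 0 := by
    simpa using ((hasDerivAt_id (0 : ℝ)).smul_const u).const_add v
  have h3 := ((h2.norm_sq.const_sub 1).sqrt (by simpa using h1.ne')).const_sub 1
  refine h3.congr_deriv ?_
  simp only [zero_smul, add_zero, momOfVel, real_inner_smul_left]
  field_simp

end Kinematics

/-! ### The discrete action and its minimizers. -/

section Polygons

variable {E : Type*} [NormedAddCommGroup E] {n : ℕ} [NeZero n]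

lemma norm_sub_zero_le_of_step_le {Q : ZMod n → E} {h : ℝ} (hQ : ∀ k, ‖Q (k + 1) - Q k‖ ≤ h)
    (k : ZMod n) : ‖Q k - Q 0‖ ≤ n * h := by
  have hh : 0 ≤ h := (norm_nonneg _).trans (hQ 0)
  have key (j : ℕ) : ‖Q (j : ZMod n) - Q 0‖ ≤ j * h := by
    induction j with
    | zero => simp
    | succ j ih =>
      have := norm_sub_le_norm_sub_add_norm_sub (Q ((j + 1 : ℕ) : ZMod n)) (Q (j : ZMod n)) (Q 0)
      have h2 := hQ (j : ZMod n)
      push_cast at *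
      linarith
  have h3 := key k.val
  rw [ZMod.natCast_zmod_val] at h3
  refine h3.trans (mul_le_mul_of_nonneg_right ?_ hh)
  exact_mod_cast (ZMod.val_lt k).le

lemma sum_shift_sub (f : ZMod n → E) : ∑ k, (f (k + 1) - f k) = 0 := by
  rw [Finset.sum_sub_distrib, sub_eq_zero]
  exact Equiv.sum_comp (Equiv.addRight (1 : ZMod n)) f

variable [InnerProductSpace ℝ E]

/-- The magnetic part of the action of a closed polygon. -/
def polygonCirculation (a : ZMod n → E → E) (Q : ZMod n → E) : ℝ :=
  ∑ k, inner ℝ (a k (Q k)) (Q (k + 1) - Q k)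

/-- The kinetic part of the action of a closed polygon with time step `h`. -/
def polygonKinetic (h : ℝ) (Q : ZMod n → E) : ℝ :=
  ∑ k, h * (1 - Real.sqrt (1 - ‖h⁻¹ • (Q (k + 1) - Q k)‖ ^ 2))

/-- The relativistic action of a closed polygon with time step `h` in the vector potentials
`a k`. -/
def polygonAction (h : ℝ) (a : ZMod n → E → E) (Q : ZMod n → E) : ℝ :=
  polygonKinetic h Q + polygonCirculation a Q

/-- Closed polygons with time step `h` that are not faster than light and start in the ball of
radius `R`. -/
def causalPolygons (n : ℕ) (E : Type*) [NormedAddCommGroup E] (h R : ℝ) : Set (ZMod n → E) :=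
  {Q | ‖Q 0‖ ≤ R ∧ ∀ k, ‖Q (k + 1) - Q k‖ ≤ h}

lemma polygonKinetic_nonneg {h : ℝ} (hh : 0 ≤ h) (Q : ZMod n → E) : 0 ≤ polygonKinetic h Q := by
  refine Finset.sum_nonneg fun k _ => mul_nonneg hh (sub_nonneg.2 ?_)
  exact Real.sqrt_le_one.2 (by linarith [sq_nonneg ‖h⁻¹ • (Q (k + 1) - Q k)‖])

/-- The edges of a closed polygon sum to zero, so subtracting the same vector `b` from all
potentials leaves the circulation unchanged: only their oscillation counts. -/
lemma neg_le_polygonAction {h : ℝ} (hh : 0 ≤ h) (a : ZMod n → E → E) (Q : ZMod n → E) (b : E)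
    {B D : ℝ} (hB : ∀ k, ‖a k (Q k) - b‖ ≤ B) (hD : ∀ k, ‖Q (k + 1) - Q k‖ ≤ D) :
    -(n * (B * D)) ≤ polygonAction h a Q := by
  have hB0 : 0 ≤ B := (norm_nonneg _).trans (hB 0)
  have h1 : polygonCirculation a Q = ∑ k, inner ℝ (a k (Q k) - b) (Q (k + 1) - Q k) := by
    simp_rw [inner_sub_left, Finset.sum_sub_distrib]
    rw [← inner_sum (𝕜 := ℝ) Finset.univ (fun k => Q (k + 1) - Q k) b, sum_shift_sub, inner_zero_right,
      sub_zero, polygonCirculation]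
  have h2 : ∑ _k : ZMod n, -(B * D) ≤ polygonCirculation a Q := by
    rw [h1]
    refine Finset.sum_le_sum fun k _ => ?_
    have h3 := abs_le.1 (abs_real_inner_le_norm (a k (Q k) - b) (Q (k + 1) - Q k))
    have h4 := mul_le_mul (hB k) (hD k) (norm_nonneg _) hB0
    linarith [h3.1]
  rw [Finset.sum_const, Finset.card_univ, ZMod.card, nsmul_eq_mul] at h2
  have := polygonKinetic_nonneg hh Q
  rw [polygonAction]
  linarith

lemma continuous_polygonAction (h : ℝ) {a : ZMod n → E → E} (ha : ∀ k, Continuous (a k)) :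
    Continuous (polygonAction h a) := by
  unfold polygonAction polygonKinetic polygonCirculation
  fun_prop

lemma isCompact_causalPolygons [FiniteDimensional ℝ E] (h R : ℝ) :
    IsCompact (causalPolygons n E h R) := by
  have := FiniteDimensional.proper ℝ E
  refine Metric.isCompact_of_isClosed_isBounded ?_ ?_
  · have h0 : IsClosed {Q : ZMod n → E | ‖Q 0‖ ≤ R} := isClosed_le (by fun_prop) continuous_const
    refine h0.inter ?_
    show IsClosed {Q : ZMod n → E | ∀ k, ‖Q (k + 1) - Q k‖ ≤ h}
    rw [Set.ofPred_forall]
    exact isClosed_iInter fun k => isClosed_le (by fun_prop) continuous_const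
  · refine (Metric.isBounded_closedBall (x := 0) (r := R + n * h)).subset fun Q hQ => ?_
    have hk (k : ZMod n) : ‖Q k‖ ≤ R + n * h := by
      have h1 := norm_sub_zero_le_of_step_le hQ.2 k
      have h2 := norm_le_norm_add_norm_sub' (Q k) (Q 0)
      have h3 := hQ.1
      linarith
    rw [mem_closedBall_zero_iff]
    exact (pi_norm_le_iff_of_nonneg ((norm_nonneg _).trans (hk 0))).2 hk

lemma hasDerivAt_polygonCirculation {a : ZMod n → E → E} (ha : ∀ k, Differentiable ℝ (a k))
    (Q η : ZMod n → E) :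
    HasDerivAt (fun s : ℝ => polygonCirculation a (Q + s • η))
      (∑ k, (inner ℝ (a k (Q k)) (η (k + 1) - η k) +
        inner ℝ (fderiv ℝ (a k) (Q k) (η k)) (Q (k + 1) - Q k))) 0 := by
  unfold polygonCirculation
  refine HasDerivAt.fun_sum fun k _ => ?_
  have h1 (j : ZMod n) : HasDerivAt (fun s : ℝ => (Q + s • η) j) (η j) 0 := by
    simpa using ((hasDerivAt_id (0 : ℝ)).smul_const (η j)).const_add (Q j)
  have h2 : HasDerivAt (fun s : ℝ => a k ((Q + s • η) k)) (fderiv ℝ (a k) (Q k) (η k)) 0 := by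
    have h3 : HasFDerivAt (a k) (fderiv ℝ (a k) (Q k)) ((Q + (0 : ℝ) • η) k) := by
      simpa using (ha k (Q k)).hasFDerivAt
    exact h3.comp_hasDerivAt 0 (h1 k)
  simpa using h2.inner ℝ ((h1 (k + 1)).sub (h1 k))

lemma hasDerivAt_polygonKinetic {h : ℝ} (hh : 0 < h) {Q : ZMod n → E}
    (hQ : ∀ k, ‖Q (k + 1) - Q k‖ < h) (η : ZMod n → E) :
    HasDerivAt (fun s : ℝ => polygonKinetic h (Q + s • η))
      (∑ k, inner ℝ (momOfVel (h⁻¹ • (Q (k + 1) - Q k))) (η (k + 1) - η k)) 0 := by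
  unfold polygonKinetic
  refine HasDerivAt.fun_sum fun k _ => ?_
  have h1 : ‖h⁻¹ • (Q (k + 1) - Q k)‖ < 1 := by
    rw [norm_smul, norm_inv, Real.norm_of_nonneg hh.le, inv_mul_lt_one₀ hh]
    exact hQ k
  have h2 := (hasDerivAt_one_sub_sqrt (u := h⁻¹ • (η (k + 1) - η k)) h1).const_mul h
  rw [real_inner_smul_right, mul_inv_cancel_left₀ hh.ne'] at h2
  refine h2.congr_of_eventuallyEq (Filter.Eventually.of_forall fun s => ?_)
  simp only [Pi.add_apply, Pi.smul_apply]
  congr 6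
  module

/-- Closed polygons minimizing the action move with less than the speed of light: otherwise, a
contraction towards the starting point decreases the kinetic part at infinite rate. -/
lemma step_lt_of_isMinOn {h R : ℝ} (hh : 0 < h) {a : ZMod n → E → E}
    (ha : ∀ k, Differentiable ℝ (a k)) {Q : ZMod n → E} (hQ : Q ∈ causalPolygons n E h R)
    (hmin : IsMinOn (polygonAction h a) (causalPolygons n E h R) Q) (k : ZMod n) :
    ‖Q (k + 1) - Q k‖ < h := by
  refine lt_of_le_of_ne (hQ.2 k) fun hk => ?_
  set η : ZMod n → E := fun j => Q 0 - Q j with hη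
  have hd (s : ℝ) (j : ZMod n) :
      (Q + s • η) (j + 1) - (Q + s • η) j = (1 - s) • (Q (j + 1) - Q j) := by
    simp only [hη, Pi.add_apply, Pi.smul_apply]; module
  have hvel (j : ZMod n) : ‖h⁻¹ • (Q (j + 1) - Q j)‖ ≤ 1 := by
    rw [norm_smul, norm_inv, Real.norm_of_nonneg hh.le, inv_mul_le_one₀ hh]
    exact hQ.2 j
  have hkin {s : ℝ} (hs0 : 0 ≤ s) (hs1 : s ≤ 1) :
      polygonKinetic h (Q + s • η) + h * Real.sqrt s ≤ polygonKinetic h Q := by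
    rw [← le_sub_iff_add_le', polygonKinetic, polygonKinetic, ← Finset.sum_sub_distrib]
    simp only [hd, smul_comm h⁻¹ (1 - s), norm_smul (1 - s), mul_pow, Real.norm_eq_abs, sq_abs]
    have hpos (j : ZMod n) : 0 ≤ h * (1 - √(1 - ‖h⁻¹ • (Q (j + 1) - Q j)‖ ^ 2)) -
        h * (1 - √(1 - (1 - s) ^ 2 * ‖h⁻¹ • (Q (j + 1) - Q j)‖ ^ 2)) := by
      rw [← mul_sub]
      refine mul_nonneg hh.le ?_
      have : √(1 - ‖h⁻¹ • (Q (j + 1) - Q j)‖ ^ 2) ≤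
          √(1 - (1 - s) ^ 2 * ‖h⁻¹ • (Q (j + 1) - Q j)‖ ^ 2) :=
        Real.sqrt_le_sqrt (sub_le_sub_left (mul_le_of_le_one_left (sq_nonneg _) (by nlinarith)) 1)
      linarith
    -- No edge loses from the contraction, so the gain of the single luminal edge `k` suffices; it
    -- is at least `h√s` since `1 - (1 - s)² ≥ s` on `[0, 1]`.
    refine le_trans ?_ (Finset.single_le_sum (fun j _ => hpos j) (Finset.mem_univ k))
    have h1 : ‖h⁻¹ • (Q (k + 1) - Q k)‖ = 1 := by
      rw [norm_smul, norm_inv, Real.norm_of_nonneg hh.le, hk, inv_mul_cancel₀ hh.ne']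
    rw [h1, ← mul_sub]
    refine mul_le_mul_of_nonneg_left ?_ hh.le
    have : √s ≤ √(1 - (1 - s) ^ 2 * 1 ^ 2) := Real.sqrt_le_sqrt (by nlinarith)
    simpa using this
  have hmem {s : ℝ} (hs0 : 0 ≤ s) (hs1 : s ≤ 1) : Q + s • η ∈ causalPolygons n E h R := by
    refine ⟨by simpa [hη] using hQ.1, fun j => ?_⟩
    rw [hd, norm_smul, Real.norm_of_nonneg (by linarith)]
    exact (mul_le_of_le_one_left (norm_nonneg _) (by linarith)).trans (hQ.2 j)
  -- The circulation is differentiable in `s`, so it changes by at most `C s`; minimality then gives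
  -- `h√s ≤ C s`, which fails as `s → 0`.
  obtain ⟨C, hC⟩ := (hasDerivAt_polygonCirculation ha Q η).isBigO_sub.bound
  obtain ⟨ε, hε, hball⟩ := Metric.eventually_nhds_iff.1 hC
  have hineq {s : ℝ} (hs0 : 0 < s) (hs1 : s ≤ 1) (hsε : s < ε) : h * √s ≤ C * s := by
    have h1 := hball (y := s) (by simpa [abs_of_pos hs0] using hsε)
    simp only [zero_smul, add_zero, sub_zero, Real.norm_eq_abs, abs_of_pos hs0] at h1
    have h2 := hmin (hmem hs0.le hs1)
    have h3 := hkin hs0.le hs1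
    simp only [polygonAction, Set.mem_ofPred_eq] at h2
    linarith [le_abs_self (polygonCirculation a (Q + s • η) - polygonCirculation a Q)]
  have hlim : Filter.Tendsto (fun s : ℝ => C * √s) (𝓝[>] 0) (𝓝 0) := by
    have : Filter.Tendsto (fun s : ℝ => C * √s) (𝓝 0) (𝓝 (C * √0)) :=
      (by fun_prop : Continuous fun s : ℝ => C * √s).tendsto 0
    simpa using this.mono_left nhdsWithin_le_nhds
  have hev : ∀ᶠ s : ℝ in 𝓝[>] 0, h ≤ C * √s := by
    filter_upwards [Ioo_mem_nhdsGT (lt_min one_pos hε)] with s hs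
    have hs2 := hineq hs.1 (hs.2.le.trans (min_le_left _ _)) (hs.2.trans_le (min_le_right _ _))
    have h4 : 0 < √s := Real.sqrt_pos.2 hs.1
    refine le_of_mul_le_mul_right ?_ h4
    rwa [mul_assoc, Real.mul_self_sqrt hs.1.le]
  exact hh.not_ge (ge_of_tendsto hlim hev)

/-- The discrete Euler-Lagrange equation for closed polygons minimizing the action. -/
lemma momOfVel_succ_sub_of_isMinOn [FiniteDimensional ℝ E] {h R : ℝ} (hh : 0 < h)
    {a : ZMod n → E → E} (ha : ∀ k, Differentiable ℝ (a k)) {Q : ZMod n → E}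
    (hQ : Q ∈ causalPolygons n E h R) (hQR : ‖Q 0‖ < R)
    (hmin : IsMinOn (polygonAction h a) (causalPolygons n E h R) Q) (k : ZMod n) :
    momOfVel (h⁻¹ • (Q (k + 1 + 1) - Q (k + 1))) - momOfVel (h⁻¹ • (Q (k + 1) - Q k)) =
      ContinuousLinearMap.adjoint (fderiv ℝ (a (k + 1)) (Q (k + 1))) (Q (k + 1 + 1) - Q (k + 1)) -
        (a (k + 1) (Q (k + 1)) - a k (Q k)) := by
  have hlt := step_lt_of_isMinOn hh ha hQ hmin
  set X : ZMod n → E := fun j => momOfVel (h⁻¹ • (Q (j + 1) - Q j)) + a j (Q j) with hX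
  set Y : ZMod n → E := fun j =>
    ContinuousLinearMap.adjoint (fderiv ℝ (a j) (Q j)) (Q (j + 1) - Q j) with hY
  -- Both constraints are strict at `Q`, so small variations in every direction `η` are admissible.
  have hzero (η : ZMod n → E) :
      ∑ j, (inner ℝ (X j) (η (j + 1) - η j) + inner ℝ (Y j) (η j)) = 0 := by
    have hder := (hasDerivAt_polygonKinetic hh hlt η).add (hasDerivAt_polygonCirculation ha Q η)
    have hloc : IsLocalMin (fun s : ℝ => polygonAction h a (Q + s • η)) 0 := by
      have h1 : ∀ᶠ s : ℝ in 𝓝 0, ‖(Q + s • η) 0‖ < R := by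
        refine ContinuousAt.eventually_lt (by fun_prop) continuousAt_const ?_
        simpa using hQR
      have h2 (j : ZMod n) : ∀ᶠ s : ℝ in 𝓝 0, ‖(Q + s • η) (j + 1) - (Q + s • η) j‖ < h := by
        refine ContinuousAt.eventually_lt (by fun_prop) continuousAt_const ?_
        simpa using hlt j
      filter_upwards [h1, Filter.eventually_all.2 h2] with s hs1 hs2
      have := hmin (a := Q + s • η) ⟨hs1.le, fun j => (hs2 j).le⟩
      simpa using this
    have h0 := hloc.hasDerivAt_eq_zero hder
    rw [← h0, ← Finset.sum_add_distrib]
    refine Finset.sum_congr rfl fun j _ => ?_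
    rw [hX, hY]
    simp only [inner_add_left, ContinuousLinearMap.adjoint_inner_left]
    rw [real_inner_comm (Q (j + 1) - Q j), add_assoc]
  -- Summation by parts on the cyclic group, without boundary terms.
  have hsum (η : ZMod n → E) : ∑ j, inner ℝ (X (j - 1) - X j + Y j) (η j) = 0 := by
    rw [← hzero η]
    simp only [inner_add_left, inner_sub_left, inner_sub_right, Finset.sum_add_distrib,
      Finset.sum_sub_distrib]
    congr 2
    rw [← Equiv.sum_comp (Equiv.addRight (1 : ZMod n))]
    simp
  -- The gradient is tested against itself.
  have hXY := hsum fun j => X (j - 1) - X j + Y j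
  have h1 := (Finset.sum_eq_zero_iff_of_nonneg fun j _ => real_inner_self_nonneg).1 hXY (k + 1)
    (Finset.mem_univ _)
  rw [inner_self_eq_zero, add_sub_cancel_right, hX, hY] at h1
  rw [← sub_eq_zero, ← neg_eq_zero, ← h1]
  dsimp only
  abel

end Polygons

/-! ### Limits of grid functions as the time step tends to zero. -/

section ContinuumLimit

open Filter

variable {F : Type*} [NormedAddCommGroup F] [NormedSpace ℝ F]

/-- A telescoping mean value inequality. The case `a = 0` gives Lipschitz bounds; `a = h • y'` gives
differentiability of the limit. -/
lemma norm_sub_sub_smul_le_of_step {x : ℤ → F} {a : F} {ε : ℝ} {j k : ℤ} (hjk : j ≤ k)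
    (hx : ∀ i, j ≤ i → i < k → ‖x (i + 1) - x i - a‖ ≤ ε) :
    ‖x k - x j - ((k : ℝ) - j) • a‖ ≤ ε * ((k : ℝ) - j) := by
  induction k, hjk using Int.leInduction with
  | base => simp
  | succ k hjk ih =>
    have h1 := ih fun i hi hik => hx i hi (by omega)
    have h2 := hx k hjk (by omega)
    have h3 : x (k + 1) - x j - (((k + 1 : ℤ) : ℝ) - j) • a =
        (x (k + 1) - x k - a) + (x k - x j - ((k : ℝ) - j) • a) := by
      push_cast; module
    rw [h3]
    refine (norm_add_le _ _).trans ?_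
    push_cast
    linarith

/-- The filter of pairs `(n, i)` for which `n` is large with respect to `U` and the grid time
`i * h n` is close to `s`. -/
def nearTime (U : Filter ℕ) (h : ℕ → ℝ) (s : ℝ) : Filter (ℕ × ℤ) :=
  comap Prod.fst U ⊓ comap (fun z => z.2 * h z.1) (𝓝 s)

variable {U : Filter ℕ} {h : ℕ → ℝ} {s : ℝ}

lemma tendsto_fst_nearTime : Tendsto Prod.fst (nearTime U h s) U :=
  tendsto_comap.mono_left inf_le_left

lemma tendsto_time_nearTime : Tendsto (fun z : ℕ × ℤ => z.2 * h z.1) (nearTime U h s) (𝓝 s) :=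
  tendsto_comap.mono_left inf_le_right

lemma tendsto_nearTime_iff {α : Type*} {l : Filter α} {f : α → ℕ × ℤ} :
    Tendsto f l (nearTime U h s) ↔
      Tendsto (fun x => (f x).1) l U ∧ Tendsto (fun x => (f x).2 * h (f x).1) l (𝓝 s) := by
  rw [nearTime, tendsto_inf, tendsto_comap_iff, tendsto_comap_iff]
  rfl

lemma tendsto_succ_nearTime (h0 : Tendsto h U (𝓝 0)) :
    Tendsto (fun z : ℕ × ℤ => (z.1, z.2 + 1)) (nearTime U h s) (nearTime U h s) := by
  refine tendsto_nearTime_iff.2 ⟨tendsto_fst_nearTime, ?_⟩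
  have := (tendsto_time_nearTime (U := U) (h := h) (s := s)).add
    (h0.comp (tendsto_fst_nearTime (h := h) (s := s)))
  rw [add_zero] at this
  refine this.congr fun z => ?_
  simp only [Function.comp_apply]
  push_cast
  ring

lemma abs_floor_div_mul_sub_le {δ : ℝ} (hδ : 0 < δ) (s : ℝ) : |⌊s / δ⌋ * δ - s| ≤ δ := by
  have h1 := Int.floor_le (s / δ)
  have h2 := (Int.lt_floor_add_one (s / δ)).le
  rw [le_div_iff₀ hδ] at h1
  rw [div_le_iff₀ hδ] at h2
  rw [abs_le]
  constructor <;> linarith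

lemma tendsto_floor_nearTime (hpos : ∀ᶠ n in U, 0 < h n) (h0 : Tendsto h U (𝓝 0)) (s : ℝ) :
    Tendsto (fun n => (n, ⌊s / h n⌋)) U (nearTime U h s) := by
  refine tendsto_nearTime_iff.2 ⟨tendsto_id, ?_⟩
  rw [tendsto_iff_norm_sub_tendsto_zero]
  refine squeeze_zero' (Eventually.of_forall fun _ => norm_nonneg _) ?_ h0
  filter_upwards [hpos] with n hn
  exact abs_floor_div_mul_sub_le hn s

/-- A uniform discrete Lipschitz bound upgrades convergence at the one index `⌊s / h n⌋` to
convergence at all grid times approaching `s`; this plays the role of equicontinuity. -/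
lemma tendsto_nearTime_of_step_le {Y : ℕ → ℤ → F} {C : ℝ} {y : F} (hpos : ∀ᶠ n in U, 0 < h n)
    (h0 : Tendsto h U (𝓝 0)) (hY : ∀ᶠ n in U, ∀ i, ‖Y n (i + 1) - Y n i‖ ≤ C * h n)
    (hy : Tendsto (fun n => Y n ⌊s / h n⌋) U (𝓝 y)) :
    Tendsto (fun z : ℕ × ℤ => Y z.1 z.2) (nearTime U h s) (𝓝 y) := by
  have hdiff : Tendsto (fun z : ℕ × ℤ => Y z.1 z.2 - Y z.1 ⌊s / h z.1⌋) (nearTime U h s) (𝓝 0) := by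
    rw [tendsto_zero_iff_norm_tendsto_zero]
    have hlim : Tendsto (fun z : ℕ × ℤ => C * |z.2 * h z.1 - ⌊s / h z.1⌋ * h z.1|)
        (nearTime U h s) (𝓝 0) := by
      have h1 := ((tendsto_time_nearTime (U := U) (h := h) (s := s)).sub
        (tendsto_time_nearTime.comp ((tendsto_floor_nearTime hpos h0 s).comp
          tendsto_fst_nearTime))).abs.const_mul C
      simpa using h1
    refine squeeze_zero' (Eventually.of_forall fun _ => norm_nonneg _) ?_ hlim
    filter_upwards [tendsto_fst_nearTime.eventually hY, tendsto_fst_nearTime.eventually hpos]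
      with z hz hp
    have key {j k : ℤ} (hjk : j ≤ k) :
        ‖Y z.1 k - Y z.1 j‖ ≤ C * |(k : ℝ) * h z.1 - j * h z.1| := by
      have h2 := norm_sub_sub_smul_le_of_step (x := Y z.1) (a := (0 : F)) hjk
        (fun i _ _ => by simpa using hz i)
      rw [smul_zero, sub_zero] at h2
      rw [← sub_mul, abs_mul, abs_of_pos hp, abs_of_nonneg (by
        rw [sub_nonneg]; exact_mod_cast hjk)]
      linarith
    rcases le_total ⌊s / h z.1⌋ z.2 with hle | hle
    · exact key hle
    · rw [norm_sub_rev, abs_sub_comm]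
      exact key hle
  have := hdiff.add (hy.comp tendsto_fst_nearTime)
  simpa using this

/-- A pointwise limit of grid functions whose difference quotients converge locally uniformly
near time `s` is differentiable at `s`. -/
lemma hasDerivAt_of_tendsto_nearTime [U.NeBot] {Y : ℕ → ℤ → F} {y : ℝ → F} {a : F}
    (hpos : ∀ᶠ n in U, 0 < h n) (h0 : Tendsto h U (𝓝 0))
    (hy : ∀ t, Tendsto (fun n => Y n ⌊t / h n⌋) U (𝓝 (y t)))
    (ha : Tendsto (fun z : ℕ × ℤ => (h z.1)⁻¹ • (Y z.1 (z.2 + 1) - Y z.1 z.2)) (nearTime U h s)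
      (𝓝 a)) :
    HasDerivAt y a s := by
  rw [hasDerivAt_iff_isLittleO, Asymptotics.isLittleO_iff]
  intro ε hε
  have h1 := (Metric.tendsto_nhds.1 ha ε hε)
  rw [nearTime, ((U.basis_sets.comap _).inf ((Metric.nhds_basis_ball).comap _)).eventually_iff] at h1
  obtain ⟨⟨V, δ⟩, ⟨hV, hδ⟩, hVδ⟩ := h1
  -- Half of `δ` is reserved for rounding to the grid, once `h n < δ / 2`.
  filter_upwards [Metric.ball_mem_nhds s (half_pos hδ)] with t ht
  rw [Metric.mem_ball, Real.dist_eq] at ht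
  have hgrid (r : ℝ) : Tendsto (fun n => (⌊r / h n⌋ : ℝ) * h n) U (𝓝 r) :=
    tendsto_time_nearTime.comp (tendsto_floor_nearTime hpos h0 r)
  have hL : Tendsto (fun n => ‖Y n ⌊t / h n⌋ - Y n ⌊s / h n⌋ -
      ((⌊t / h n⌋ : ℝ) * h n - ⌊s / h n⌋ * h n) • a‖) U (𝓝 ‖y t - y s - (t - s) • a‖) :=
    (((hy t).sub (hy s)).sub (((hgrid t).sub (hgrid s)).smul_const a)).norm
  have hR : Tendsto (fun n => ε * |(⌊t / h n⌋ : ℝ) * h n - ⌊s / h n⌋ * h n|) U (𝓝 (ε * |t - s|)) :=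
    (((hgrid t).sub (hgrid s)).abs).const_mul ε
  refine le_of_tendsto_of_tendsto hL hR ?_
  filter_upwards [hV, hpos, h0.eventually (gt_mem_nhds (half_pos hδ))] with n hnV hn hnδ
  have ht1 := abs_le.1 (abs_floor_div_mul_sub_le hn t)
  have hs1 := abs_le.1 (abs_floor_div_mul_sub_le hn s)
  have ht2 := abs_lt.1 ht
  have hstep {i : ℤ} (h1 : s - δ < i * h n) (h2 : i * h n < s + δ) :
      ‖Y n (i + 1) - Y n i - h n • a‖ ≤ ε * h n := by
    have h3 : ‖(h n)⁻¹ • (Y n (i + 1) - Y n i) - a‖ ≤ ε := by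
      rw [← dist_eq_norm]
      refine (hVδ (x := (n, i)) ⟨hnV, ?_⟩).le
      rw [Set.mem_preimage, Metric.mem_ball, Real.dist_eq, abs_lt]
      constructor <;> simp only <;> linarith
    have h4 : Y n (i + 1) - Y n i - h n • a = h n • ((h n)⁻¹ • (Y n (i + 1) - Y n i) - a) := by
      rw [smul_sub, smul_inv_smul₀ hn.ne']
    rw [h4, norm_smul, Real.norm_of_nonneg hn.le, mul_comm]
    exact mul_le_mul_of_nonneg_right h3 hn.le
  have key {j k : ℤ} (hjk : j ≤ k) (hj : s - δ < j * h n) (hk : k * h n < s + δ + h n) :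
      ‖Y n k - Y n j - ((k : ℝ) * h n - j * h n) • a‖ ≤ ε * |(k : ℝ) * h n - j * h n| := by
    have h5 := norm_sub_sub_smul_le_of_step (x := Y n) (a := h n • a) (ε := ε * h n) hjk
      fun i hji hik => by
        have hji' : (j : ℝ) ≤ i := by exact_mod_cast hji
        have hik' : (i : ℝ) + 1 ≤ k := by exact_mod_cast hik
        exact hstep (by nlinarith) (by nlinarith)
    have hjk' : (0 : ℝ) ≤ (k : ℝ) - j := by rw [sub_nonneg]; exact_mod_cast hjk
    rw [← sub_mul, abs_mul, abs_of_pos hn, abs_of_nonneg hjk', mul_smul]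
    linarith
  rcases le_total ⌊s / h n⌋ ⌊t / h n⌋ with hle | hle
  · exact key hle (by linarith) (by linarith)
  · have := key hle (by linarith) (by linarith)
    rw [abs_sub_comm, ← norm_neg]
    refine le_trans (le_of_eq (congrArg _ ?_)) this
    module

end ContinuumLimit

/-! ### Bounds on the potential and the form of the Lorentz force. -/

section VectorPotential

open Filter

variable {T : ℝ} {A : ℝ → E3 → E3}

lemma timeDeriv_eq_fderiv (hA : ContDiff ℝ 1 (fun p : ℝ × E3 => A p.1 p.2)) (t : ℝ) (x : E3) :
    timeDeriv A t x = fderiv ℝ (fun p : ℝ × E3 => A p.1 p.2) (t, x) (1, 0) := by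
  have h1 := ((hA.differentiable one_ne_zero) (t, x)).hasFDerivAt
  have h2 : HasDerivAt (fun s : ℝ => (s, x)) ((1 : ℝ), (0 : E3)) t :=
    (hasDerivAt_id t).prodMk (hasDerivAt_const t x)
  exact (h1.comp_hasDerivAt t h2).deriv

lemma hasFDerivAt_potential (hA : ContDiff ℝ 1 (fun p : ℝ × E3 => A p.1 p.2)) (t : ℝ) (x : E3) :
    HasFDerivAt (A t) ((fderiv ℝ (fun p : ℝ × E3 => A p.1 p.2) (t, x)).comp
      (ContinuousLinearMap.inr ℝ ℝ E3)) x :=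
  ((hA.differentiable one_ne_zero) (t, x)).hasFDerivAt.comp x (hasFDerivAt_prodMk_right t x)

lemma fderiv_uncurry_apply (hA : ContDiff ℝ 1 (fun p : ℝ × E3 => A p.1 p.2)) (t : ℝ) (x : E3)
    (s : ℝ) (y : E3) :
    fderiv ℝ (fun p : ℝ × E3 => A p.1 p.2) (t, x) (s, y) =
      s • timeDeriv A t x + fderiv ℝ (A t) x y := by
  rw [timeDeriv_eq_fderiv hA, (hasFDerivAt_potential hA t x).fderiv, ← map_smul]
  simp [← map_add]

lemma norm_fderiv_uncurry_le (hA : ContDiff ℝ 1 (fun p : ℝ × E3 => A p.1 p.2)) (t : ℝ) (x : E3) :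
    ‖fderiv ℝ (fun p : ℝ × E3 => A p.1 p.2) (t, x)‖ ≤
      ‖timeDeriv A t x‖ + ‖fderiv ℝ (A t) x‖ := by
  refine ContinuousLinearMap.opNorm_le_bound _ (by positivity) fun z => ?_
  obtain ⟨s, y⟩ := z
  rw [fderiv_uncurry_apply hA, add_mul]
  refine (norm_add_le _ _).trans (add_le_add ?_ ?_)
  · rw [norm_smul, mul_comm]
    exact mul_le_mul_of_nonneg_left (norm_fst_le (s, y)) (norm_nonneg _)
  · exact (ContinuousLinearMap.le_opNorm _ _).trans
      (mul_le_mul_of_nonneg_left (norm_snd_le (s, y)) (norm_nonneg _))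

lemma exists_norm_fderiv_uncurry_le_of_decay
    (hA : ContDiff ℝ 1 (fun p : ℝ × E3 => A p.1 p.2))
    (hdecay : TendstoUniformly (fun (x : E3) (t : ℝ) => ‖timeDeriv A t x‖ + ‖fderiv ℝ (A t) x‖)
      (fun _ : ℝ => (0 : ℝ)) (Bornology.cobounded E3)) {ε : ℝ} (hε : 0 < ε) :
    ∃ R : ℝ, ∀ (t : ℝ) (x : E3), R ≤ ‖x‖ →
      ‖fderiv ℝ (fun p : ℝ × E3 => A p.1 p.2) (t, x)‖ ≤ ε := by
  have h1 := Metric.tendstoUniformly_iff.1 hdecay ε hε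
  obtain ⟨R, -, hR⟩ := (hasBasis_cobounded_norm (E := E3)).eventually_iff.1 h1
  refine ⟨R, fun t x hx => (norm_fderiv_uncurry_le hA t x).trans ?_⟩
  have h2 := hR hx t
  rw [dist_comm, Real.dist_0_eq_abs] at h2
  exact (le_abs_self _).trans h2.le

lemma fderiv_uncurry_periodic (hper : ∀ (t : ℝ) (x : E3), A (t + T) x = A t x) (x : E3) :
    Function.Periodic (fun t => fderiv ℝ (fun p : ℝ × E3 => A p.1 p.2) (t, x)) T := by
  intro t
  have h1 := fderiv_comp_add_right (𝕜 := ℝ) (f := fun p : ℝ × E3 => A p.1 p.2) (x := (t, x))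
    ((T, 0) : ℝ × E3)
  simp only [Prod.fst_add, Prod.snd_add, add_zero, hper, Prod.mk_add_mk] at h1
  exact h1.symm

/-- Decay controls large `x`; periodicity in time and compactness control the rest. -/
lemma exists_norm_fderiv_uncurry_le (hT : 0 < T)
    (hA : ContDiff ℝ 1 (fun p : ℝ × E3 => A p.1 p.2))
    (hper : ∀ (t : ℝ) (x : E3), A (t + T) x = A t x)
    (hdecay : TendstoUniformly (fun (x : E3) (t : ℝ) => ‖timeDeriv A t x‖ + ‖fderiv ℝ (A t) x‖)
      (fun _ : ℝ => (0 : ℝ)) (Bornology.cobounded E3)) :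
    ∃ M : ℝ, 0 < M ∧ ∀ z : ℝ × E3, ‖fderiv ℝ (fun p : ℝ × E3 => A p.1 p.2) z‖ ≤ M := by
  obtain ⟨R, hR⟩ := exists_norm_fderiv_uncurry_le_of_decay hA hdecay one_pos
  obtain ⟨C, hC⟩ := ((isCompact_Icc (a := (0 : ℝ)) (b := T)).prod
    (isCompact_closedBall (0 : E3) R)).exists_bound_of_continuousOn
    (hA.continuous_fderiv one_ne_zero).continuousOn
  refine ⟨max 1 C, lt_max_of_lt_left one_pos, fun ⟨t, x⟩ => ?_⟩
  rcases le_total R ‖x‖ with hx | hx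
  · exact (hR t x hx).trans (le_max_left _ _)
  · obtain ⟨s, hs, hts⟩ := (fderiv_uncurry_periodic hper x).exists_mem_Ico₀ hT t
    rw [hts]
    exact (hC (s, x) ⟨Set.Ico_subset_Icc_self hs, mem_closedBall_zero_iff.2 hx⟩).trans
      (le_max_right _ _)

/-- The bound `M` is only required over a ball in space, so that this serves both as the global
Lipschitz estimate and as the small one far from the origin. -/
lemma norm_potential_sub_le (hA : ContDiff ℝ 1 (fun p : ℝ × E3 => A p.1 p.2)) {M r : ℝ} {c : E3}
    (hM : ∀ (t : ℝ) (x : E3), ‖x - c‖ ≤ r →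
      ‖fderiv ℝ (fun p : ℝ × E3 => A p.1 p.2) (t, x)‖ ≤ M) (hM0 : 0 ≤ M) (t s : ℝ) {x y : E3}
    (hx : ‖x - c‖ ≤ r) (hy : ‖y - c‖ ≤ r) : ‖A t x - A s y‖ ≤ M * (|t - s| + ‖x - y‖) := by
  have hconv : Convex ℝ ((Set.univ : Set ℝ) ×ˢ Metric.closedBall c r) :=
    convex_univ.prod (convex_closedBall c r)
  have h1 := hconv.norm_image_sub_le_of_norm_fderiv_le (𝕜 := ℝ)
    (f := fun p : ℝ × E3 => A p.1 p.2) (C := M) (x := (s, y)) (y := (t, x))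
    (fun z _ => hA.differentiable one_ne_zero z)
    (fun z hz => hM z.1 z.2 (mem_closedBall_iff_norm.1 hz.2))
    ⟨trivial, mem_closedBall_iff_norm.2 hy⟩ ⟨trivial, mem_closedBall_iff_norm.2 hx⟩
  refine h1.trans (mul_le_mul_of_nonneg_left ?_ hM0)
  rw [Prod.mk_sub_mk, Prod.norm_mk, Real.norm_eq_abs]
  exact max_le_add_of_nonneg (abs_nonneg _) (norm_nonneg _)

/-- The antisymmetric part of the Jacobian acts as a cross product with the curl. The variational
equation produces the left-hand side, the Lorentz force the right-hand side. -/
lemma adjoint_sub_apply_eq_cross3_curl3 (F : E3 → E3) (x v : E3) :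
    ContinuousLinearMap.adjoint (fderiv ℝ F x) v - fderiv ℝ F x v = cross3 v (curl3 F x) := by
  set D := fderiv ℝ F x with hD
  have hv : v = ∑ j, v j • EuclideanSpace.single j (1 : ℝ) := by
    ext i
    simp [Fin.sum_univ_three]
    fin_cases i <;> simp
  have h1 (i : Fin 3) : (ContinuousLinearMap.adjoint D v) i =
      ∑ j, v j * D (EuclideanSpace.single i 1) j := by
    have h2 := ContinuousLinearMap.adjoint_inner_right D (EuclideanSpace.single i (1 : ℝ)) v
    rw [EuclideanSpace.inner_single_left] at h2
    simpa [PiLp.inner_apply, mul_comm] using h2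
  have h3 (i : Fin 3) : (D v) i = ∑ j, v j * D (EuclideanSpace.single j 1) i := by
    conv_lhs => rw [hv]
    simp
  ext i
  rw [PiLp.sub_apply, h1, h3]
  fin_cases i <;>
    simp [cross3, curl3, partialComp, cross_apply, Fin.sum_univ_three, ← hD] <;> ring

/-- The Lorentz force, written with the Jacobian of the vector potential. -/
lemma lorentzForce_eq (hA : ContDiff ℝ 1 (fun p : ℝ × E3 => A p.1 p.2)) (t : ℝ) (x v : E3) :
    electricField A t x + cross3 v (magneticField A t x) =
      ContinuousLinearMap.adjoint (fderiv ℝ (A t) x) v -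
        fderiv ℝ (fun p : ℝ × E3 => A p.1 p.2) (t, x) (1, v) := by
  rw [fderiv_uncurry_apply hA, electricField, magneticField, ← adjoint_sub_apply_eq_cross3_curl3]
  module

lemma norm_fderiv_potential_le (hA : ContDiff ℝ 1 (fun p : ℝ × E3 => A p.1 p.2)) (t : ℝ) (x : E3) :
    ‖fderiv ℝ (A t) x‖ ≤ ‖fderiv ℝ (fun p : ℝ × E3 => A p.1 p.2) (t, x)‖ := by
  refine ContinuousLinearMap.opNorm_le_bound _ (norm_nonneg _) fun y => ?_
  rw [(hasFDerivAt_potential hA t x).fderiv, ContinuousLinearMap.comp_apply]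
  refine (ContinuousLinearMap.le_opNorm _ _).trans ?_
  simp

lemma norm_adjoint_fderiv_apply_le (hA : ContDiff ℝ 1 (fun p : ℝ × E3 => A p.1 p.2)) {M : ℝ}
    (hM : ∀ z : ℝ × E3, ‖fderiv ℝ (fun p : ℝ × E3 => A p.1 p.2) z‖ ≤ M) (t : ℝ) (x v : E3) :
    ‖ContinuousLinearMap.adjoint (fderiv ℝ (A t) x) v‖ ≤ M * ‖v‖ := by
  refine (ContinuousLinearMap.le_opNorm _ _).trans (mul_le_mul_of_nonneg_right ?_ (norm_nonneg v))
  rw [LinearIsometryEquiv.norm_map]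
  exact (norm_fderiv_potential_le hA t x).trans (hM _)

/-- The estimate yields `2 * M`; the constant `3 * M` is the one that also bounds the momentum steps
of discrete orbits. -/
lemma norm_lorentzForce_le (hA : ContDiff ℝ 1 (fun p : ℝ × E3 => A p.1 p.2)) {M : ℝ}
    (hM : ∀ z : ℝ × E3, ‖fderiv ℝ (fun p : ℝ × E3 => A p.1 p.2) z‖ ≤ M) (t : ℝ) (x : E3) {v : E3}
    (hv : ‖v‖ ≤ 1) : ‖electricField A t x + cross3 v (magneticField A t x)‖ ≤ 3 * M := by
  have hM0 : 0 ≤ M := (norm_nonneg _).trans (hM 0)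
  rw [lorentzForce_eq hA]
  refine (norm_sub_le _ _).trans ?_
  have h1 := norm_adjoint_fderiv_apply_le hA hM t x v
  have h2 := ContinuousLinearMap.le_of_opNorm_le _ (hM (t, x)) ((1 : ℝ), v)
  have h3 : ‖((1 : ℝ), v)‖ ≤ 1 := by simp [Prod.norm_mk, hv]
  nlinarith

end VectorPotential

/-! ### The a priori bound on the speed of periodic solutions. -/

section SpeedBound

variable {T : ℝ} {A : ℝ → E3 → E3} {q : ℝ → E3}

lemma IsPeriodicLFESolution.norm_deriv_lt_one (hq : IsPeriodicLFESolution T A q) (t : ℝ) :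
    ‖deriv q t‖ < 1 := by
  have h1 : ‖deriv q t‖ₑ < 1 := (le_iSup (fun t => ‖deriv q t‖ₑ) t).trans_lt hq.subluminal
  rw [← ofReal_norm, ENNReal.ofReal_lt_one] at h1
  exact h1

/-- A momentum larger than `C * T` cannot turn around within one period under a force bounded by
`C`. -/
lemma norm_momentum_le_of_periodic {E : Type*} [NormedAddCommGroup E] [InnerProductSpace ℝ E]
    {q p p' : ℝ → E} {C : ℝ} (hT : 0 < T) (hq : ∀ t, HasDerivAt q (velOfMom (p t)) t)
    (hper : Function.Periodic q T) (hp : ∀ t, HasDerivAt p (p' t) t) (hC : ∀ t, ‖p' t‖ ≤ C)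
    (s : ℝ) : ‖p s‖ ≤ C * T := by
  by_contra! hs
  have hC0 : 0 ≤ C := (norm_nonneg _).trans (hC 0)
  have hps : 0 < ‖p s‖ := (mul_nonneg hC0 hT.le).trans_lt hs
  have hlip (t : ℝ) : ‖p t - p s‖ ≤ C * ‖t - s‖ :=
    convex_univ.norm_image_sub_le_of_norm_hasDerivWithin_le (fun t _ => (hp t).hasDerivWithinAt)
      (fun t _ => hC t) trivial trivial
  have hder (t : ℝ) : HasDerivAt (fun t => inner ℝ (q t) (p s)) (inner ℝ (velOfMom (p t)) (p s)) t :=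
    by simpa using (hq t).inner ℝ (hasDerivAt_const t (p s))
  -- Within one period `p t` stays closer to `p s` than `‖p s‖`, so the velocity has a positive
  -- component along `p s`, and `q` cannot return.
  have hmono : StrictMonoOn (fun t => inner ℝ (q t) (p s)) (Set.Icc s (s + T)) := by
    refine strictMonoOn_of_deriv_pos (convex_Icc _ _)
      (fun t _ => (hder t).continuousAt.continuousWithinAt) fun t ht => ?_
    rw [interior_Icc] at ht
    rw [(hder t).deriv]
    refine inner_velOfMom_pos ?_
    have h1 : ‖p t - p s‖ ≤ C * T := by
      refine (hlip t).trans (mul_le_mul_of_nonneg_left ?_ hC0)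
      rw [Real.norm_of_nonneg (by linarith [ht.1])]
      linarith [ht.2]
    have h2 : inner ℝ (p t) (p s) = inner ℝ (p t - p s) (p s) + ‖p s‖ ^ 2 := by
      rw [inner_sub_left, real_inner_self_eq_norm_sq]; ring
    have h3 := (abs_le.1 (abs_real_inner_le_norm (p t - p s) (p s))).1
    nlinarith
  have h4 := hmono ⟨le_rfl, by linarith⟩ ⟨by linarith, le_rfl⟩ (by linarith : s < s + T)
  simp only [hper s, lt_irrefl] at h4

lemma IsPeriodicLFESolution.velocitySup_le (hT : 0 < T)
    (hA : ContDiff ℝ 1 (fun p : ℝ × E3 => A p.1 p.2)) {M : ℝ}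
    (hM : ∀ z : ℝ × E3, ‖fderiv ℝ (fun p : ℝ × E3 => A p.1 p.2) z‖ ≤ M)
    (hq : IsPeriodicLFESolution T A q) :
    velocitySup q ≤ ENNReal.ofReal (3 * M * T / Real.sqrt (1 + (3 * M * T) ^ 2)) := by
  have hv (t : ℝ) : velOfMom (relMomentum q t) = deriv q t :=
    velOfMom_momOfVel (hq.norm_deriv_lt_one t)
  refine iSup_le fun t => ?_
  rw [← ofReal_norm, ← hv]
  refine ENNReal.ofReal_le_ofReal (norm_velOfMom_le_of_norm_le ?_)
  refine norm_momentum_le_of_periodic hT (fun t => ?_) hq.periodic hq.equation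
    (fun t => norm_lorentzForce_le hA hM t _ (hq.norm_deriv_lt_one t).le) t
  rw [hv]
  exact (hq.contDiff.differentiable two_ne_zero t).hasDerivAt

end SpeedBound

/-! ### Test polygons with negative action. -/

section DiscreteOrbits

open Filter

/-- The vector potentials at the grid times `k * (T / n)`. -/
def gridPotential (T : ℝ) (A : ℝ → E3 → E3) (n : ℕ) (k : ZMod n) : E3 → E3 :=
  A (k.val * (T / n))

variable {T : ℝ} {A : ℝ → E3 → E3} {n : ℕ} [NeZero n]

/-- Only the wrap-around at `k = n - 1` matters: there `(k + 1).val` is `0` instead of `n`. -/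
lemma apply_val_succ_mul {F : Type*} {f : ℝ → F} (hf : f T = f 0) (k : ZMod n) :
    f ((k + 1).val * (T / n)) = f ((k.val + 1) * (T / n)) := by
  have hn : (n : ℝ) ≠ 0 := Nat.cast_ne_zero.2 (NeZero.ne n)
  have h1 : (k + 1).val = (k.val + 1) % n := by
    rw [ZMod.val_add, ZMod.val_one_eq_one_mod, Nat.add_mod_mod]
  rcases (Nat.succ_le_of_lt (ZMod.val_lt k)).lt_or_eq with h2 | h2
  · rw [h1, Nat.mod_eq_of_lt h2]; push_cast; rfl
  · have h3 : (k.val : ℝ) + 1 = n := by exact_mod_cast h2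
    rw [h1, h3, mul_div_cancel₀ T hn, show k.val + 1 = n from h2]
    simpa using hf.symm

lemma sum_zmod_val (g : ℕ → ℝ) : ∑ k : ZMod n, g k.val = ∑ i ∈ Finset.range n, g i := by
  obtain ⟨m, rfl⟩ := Nat.exists_eq_succ_of_ne_zero (NeZero.ne n)
  exact Fin.sum_univ_eq_sum_range g (m + 1)

lemma one_sub_sqrt_one_sub_le {x : ℝ} (h0 : 0 ≤ x) (h1 : x ≤ 1) : 1 - Real.sqrt (1 - x) ≤ x := by
  have : 1 - x ≤ Real.sqrt (1 - x) := Real.le_sqrt_of_sq_le (by nlinarith)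
  linarith

lemma integral_grid_le {f : ℝ → ℝ} (hf : Continuous f) {g : ℕ → ℝ}
    (hg : ∀ i < n, g i ≤ ∫ t in (i * (T / n))..((i + 1) * (T / n)), f t) :
    ∑ k : ZMod n, g k.val ≤ ∫ t in (0 : ℝ)..T, f t := by
  have hn : (n : ℝ) ≠ 0 := Nat.cast_ne_zero.2 (NeZero.ne n)
  have h1 := intervalIntegral.sum_integral_adjacent_intervals (n := n) (μ := MeasureTheory.volume)
    (f := f) (a := fun i : ℕ => i * (T / n)) fun i _ => hf.intervalIntegrable _ _
  rw [sum_zmod_val]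
  simp only [Nat.cast_zero, zero_mul, mul_div_cancel₀ T hn] at h1
  rw [← h1]
  refine Finset.sum_le_sum fun i hi => ?_
  have := hg i (Finset.mem_range.1 hi)
  push_cast
  exact this

/-- The action of the polygon obtained by moving from `c` with velocity `-ε • u`, where `u` is the
oscillating part of the potential at `c`. -/
lemma exists_polygonAction_le (hT : 0 < T) {M K ε : ℝ} (hM0 : 0 ≤ M)
    (hM : ∀ t s x y, ‖A t x - A s y‖ ≤ M * (|t - s| + ‖x - y‖)) {c : E3} {u : ℝ → E3}
    (hu : Continuous u) (hK : ∀ t ∈ Set.Icc 0 T, ‖u t‖ ≤ K) (hu0 : ∫ t in (0 : ℝ)..T, u t = 0)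
    {μ : E3} (hAu : ∀ t, A t c = u t + μ) (hε0 : 0 ≤ ε) (hε : ε * K ≤ 1) :
    ∃ Q : ZMod n → E3, Q 0 = c ∧ (∀ k, ‖Q (k + 1) - Q k‖ ≤ T / n) ∧
      polygonAction (T / n) (gridPotential T A n) Q ≤
        -ε * (∫ t in (0 : ℝ)..T, ‖u t‖ ^ 2) +
          ε * T * (ε * K ^ 2 + M * K * (T / n + ε * K * T)) := by
  have hn : (0 : ℝ) < n := Nat.cast_pos.2 (NeZero.pos n)
  have hh : 0 < T / n := by positivity
  have hK0 : 0 ≤ K := (norm_nonneg _).trans (hK 0 ⟨le_rfl, hT.le⟩)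
  set h := T / n with hh_def
  set w : ℝ → E3 := fun t => c - ε • ∫ r in (0 : ℝ)..t, u r with hw
  have hint (a b : ℝ) : IntervalIntegrable u MeasureTheory.volume a b := hu.intervalIntegrable _ _
  have hgrid {i : ℕ} (hi : i < n) : (0 : ℝ) ≤ i * h ∧ (i + 1) * h ≤ T := by
    refine ⟨by positivity, ?_⟩
    have h1 : ((i : ℝ) + 1) ≤ n := by exact_mod_cast hi
    calc ((i : ℝ) + 1) * h ≤ n * h := mul_le_mul_of_nonneg_right h1 hh.le
      _ = T := mul_div_cancel₀ T hn.ne'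
  have hwsub (s t : ℝ) : w t - w s = -(ε • ∫ r in s..t, u r) := by
    rw [hw, ← intervalIntegral.integral_interval_sub_left (hint 0 t) (hint 0 s)]
    module
  have hnorm {s t : ℝ} (hs : 0 ≤ s) (hst : s ≤ t) (ht : t ≤ T) :
      ‖w t - w s‖ ≤ ε * K * (t - s) := by
    rw [hwsub, norm_neg, norm_smul, Real.norm_of_nonneg hε0, mul_assoc]
    refine mul_le_mul_of_nonneg_left ?_ hε0
    have := intervalIntegral.norm_integral_le_of_norm_le_const (a := s) (b := t) (f := u) (C := K)
      fun r hr => by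
        rw [Set.uIoc_of_le hst] at hr
        exact hK r ⟨hs.trans hr.1.le, hr.2.trans ht⟩
    rwa [abs_of_nonneg (sub_nonneg.2 hst)] at this
  set Q : ZMod n → E3 := fun k => w (k.val * h) with hQ
  -- The loop closes up, `w T = w 0`, because `u` has mean zero.
  have hQsucc (k : ZMod n) : Q (k + 1) = w ((k.val + 1) * h) :=
    apply_val_succ_mul (f := w) (by simp [hw, hu0]) k
  have hstep (k : ZMod n) : ‖Q (k + 1) - Q k‖ ≤ ε * K * h := by
    rw [hQsucc]
    have h1 := hgrid (ZMod.val_lt k)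
    have h2 := hnorm h1.1 (by linarith) h1.2
    have h3 : ((k.val : ℝ) + 1) * h - k.val * h = h := by ring
    rwa [h3] at h2
  refine ⟨Q, by simp [hQ, hw], fun k => (hstep k).trans (mul_le_of_le_one_left hh.le hε), ?_⟩
  have hkin : polygonKinetic h Q ≤ ε * T * (ε * K ^ 2) := by
    have h1 : polygonKinetic h Q ≤ ∑ _k : ZMod n, h * (ε * K) ^ 2 := by
      refine Finset.sum_le_sum fun k _ => mul_le_mul_of_nonneg_left ?_ hh.le
      have h2 : ‖h⁻¹ • (Q (k + 1) - Q k)‖ ≤ ε * K := by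
        rw [norm_smul, norm_inv, Real.norm_of_nonneg hh.le, inv_mul_le_iff₀ hh]
        linarith [hstep k]
      have h3 := pow_le_pow_left₀ (norm_nonneg _) h2 2
      have h4 : (ε * K) ^ 2 ≤ 1 := pow_le_one₀ (by positivity) hε
      exact (one_sub_sqrt_one_sub_le (sq_nonneg _) (h3.trans h4)).trans h3
    rw [Finset.sum_const, Finset.card_univ, ZMod.card, nsmul_eq_mul] at h1
    refine h1.trans_eq ?_
    rw [hh_def]; field_simp
  -- On each edge the potential at the vertex is replaced by `A r c`; the time differs by at most
  -- `h` and the position by at most `ε * K * T`.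
  have hcirc : polygonCirculation (gridPotential T A n) Q ≤
      ∫ t in (0 : ℝ)..T, (-ε * inner ℝ (A t c) (u t) + ε * (M * (h + ε * K * T) * K)) := by
    have hAc : Continuous fun t => A t c := by simp only [hAu]; fun_prop
    have hcont : Continuous fun t =>
      -ε * inner ℝ (A t c) (u t) + ε * (M * (h + ε * K * T) * K) := by fun_prop
    have h1 (k : ZMod n) : inner ℝ (gridPotential T A n k (Q k)) (Q (k + 1) - Q k) =
        (fun i : ℕ => inner ℝ (A (i * h) (w (i * h))) (w ((i + 1) * h) - w (i * h))) k.val := by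
      rw [hQsucc]; rfl
    unfold polygonCirculation
    simp_rw [h1]
    refine integral_grid_le hcont (g := fun i : ℕ =>
      inner ℝ (A (i * h) (w (i * h))) (w ((i + 1) * h) - w (i * h))) fun i hi => ?_
    obtain ⟨hi0, hi1⟩ := hgrid hi
    have hle : (i : ℝ) * h ≤ (i + 1) * h := by linarith
    rw [hwsub, inner_neg_right, real_inner_smul_right, ← neg_mul,
      show inner ℝ (A (i * h) (w (i * h))) (∫ r in (i * h)..((i + 1) * h), u r) =
        ∫ r in (i * h)..((i + 1) * h), inner ℝ (A (i * h) (w (i * h))) (u r) from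
        ((innerSL ℝ (A (i * h) (w (i * h)))).intervalIntegral_comp_comm (hint _ _)).symm,
      ← intervalIntegral.integral_const_mul]
    refine intervalIntegral.integral_mono_on hle
      (Continuous.intervalIntegrable (by fun_prop) _ _) (hcont.intervalIntegrable _ _) fun r hr => ?_
    have hr0 : 0 ≤ r := hi0.trans hr.1
    have hrT : r ≤ T := hr.2.trans hi1
    have h2 := hM r (i * h) c (w (i * h))
    have h3 : |r - i * h| ≤ h := by
      rw [abs_of_nonneg (by linarith [hr.1])]; linarith [hr.2]
    have h4 : ‖c - w (i * h)‖ ≤ ε * K * T := by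
      have h5 := hnorm le_rfl hi0 (by linarith)
      rw [show w 0 = c by simp [hw], norm_sub_rev] at h5
      refine h5.trans (mul_le_mul_of_nonneg_left (by linarith) (by positivity))
    have h6 : ‖A r c - A (i * h) (w (i * h))‖ ≤ M * (h + ε * K * T) :=
      h2.trans (mul_le_mul_of_nonneg_left (add_le_add h3 h4) hM0)
    have h7 := (le_abs_self _).trans
      (abs_real_inner_le_norm (A r c - A (i * h) (w (i * h))) (u r))
    rw [inner_sub_left] at h7
    have h8 := mul_le_mul h6 (hK r ⟨hr0, hrT⟩) (norm_nonneg _) (by positivity)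
    have h9 := mul_le_mul_of_nonneg_left (h7.trans h8) hε0
    linarith
  have hval : ∫ t in (0 : ℝ)..T, (-ε * inner ℝ (A t c) (u t) + ε * (M * (h + ε * K * T) * K)) =
      -ε * (∫ t in (0 : ℝ)..T, ‖u t‖ ^ 2) + T * (ε * (M * (h + ε * K * T) * K)) := by
    -- The mean `μ` is orthogonal to `u` in `L²`, which leaves `-ε ∫ ‖u‖²`.
    simp only [hAu, inner_add_left, real_inner_self_eq_norm_sq]
    rw [intervalIntegral.integral_add (Continuous.intervalIntegrable (by fun_prop) _ _)
      (Continuous.intervalIntegrable (by fun_prop) _ _), intervalIntegral.integral_const_mul,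
      intervalIntegral.integral_add (Continuous.intervalIntegrable (by fun_prop) _ _)
      (Continuous.intervalIntegrable (by fun_prop) _ _),
      show ∫ r in (0 : ℝ)..T, inner ℝ μ (u r) = inner ℝ μ (∫ r in (0 : ℝ)..T, u r) from
        (innerSL ℝ μ).intervalIntegral_comp_comm (hint _ _), hu0]
    simp
    ring
  rw [hval] at hcirc
  rw [polygonAction]
  linarith

/-- If the potential depends on time, then the action of closed polygons takes negative values,
uniformly in the time step. -/
lemma exists_polygonAction_le_neg (hT : 0 < T) {M : ℝ} (hM0 : 0 ≤ M)
    (hM : ∀ t s x y, ‖A t x - A s y‖ ≤ M * (|t - s| + ‖x - y‖))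
    (hper : ∀ (t : ℝ) (x : E3), A (t + T) x = A t x)
    (hnonaut : ∃ (t : ℝ) (x : E3), timeDeriv A t x ≠ 0) :
    ∃ (δ : ℝ) (c : E3) (N : ℕ), 0 < δ ∧ ∀ n : ℕ, N ≤ n → ∀ [NeZero n],
      ∃ Q : ZMod n → E3, Q 0 = c ∧ (∀ k, ‖Q (k + 1) - Q k‖ ≤ T / n) ∧
        polygonAction (T / n) (gridPotential T A n) Q ≤ -δ := by
  obtain ⟨t₀, c, hc⟩ := hnonaut
  have hcont : Continuous fun t => A t c := by
    refine (LipschitzWith.of_dist_le' (K := M) fun t s => ?_).continuous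
    simpa [dist_eq_norm] using hM t s c c
  set μ : E3 := T⁻¹ • ∫ t in (0 : ℝ)..T, A t c with hμ
  set u : ℝ → E3 := fun t => A t c - μ with hu_def
  have hu : Continuous u := by fun_prop
  have hu0 : ∫ t in (0 : ℝ)..T, u t = 0 := by
    rw [hu_def, intervalIntegral.integral_sub (hcont.intervalIntegrable _ _)
      (continuous_const.intervalIntegrable _ _), intervalIntegral.integral_const, hμ, sub_zero,
      smul_inv_smul₀ hT.ne', sub_self]
  obtain ⟨K, hK⟩ := (isCompact_Icc (a := (0 : ℝ)) (b := T)).exists_bound_of_continuousOn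
    hu.continuousOn
  have hK0 : 0 ≤ K := (norm_nonneg _).trans (hK 0 ⟨le_rfl, hT.le⟩)
  have hV : 0 < ∫ t in (0 : ℝ)..T, ‖u t‖ ^ 2 := by
    have h1 : ∃ t, u t ≠ 0 := by
      by_contra! h2
      refine hc ?_
      have h3 : (fun s => A s c) = fun _ => μ := funext fun s => sub_eq_zero.1 (h2 s)
      rw [timeDeriv, h3, deriv_const]
    obtain ⟨t, ht⟩ := h1
    have hup : Function.Periodic u T := fun t => by simp only [hu_def, hper]
    obtain ⟨s, hs, hts⟩ := hup.exists_mem_Ico₀ hT t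
    refine intervalIntegral.integral_pos hT (by fun_prop) (fun _ _ => by positivity)
      ⟨s, Set.Ico_subset_Icc_self hs, ?_⟩
    rw [hts] at ht
    positivity
  set V := ∫ t in (0 : ℝ)..T, ‖u t‖ ^ 2 with hV_def
  set D := T * (K ^ 2 + M * K * K * T) with hD
  have hD0 : 0 ≤ D := by positivity
  -- `ε * D` collects the second-order terms. They take a quarter of `V`, the time discretization
  -- another quarter, and a gain of `ε * (V / 2)` remains.
  obtain ⟨ε, hε0, hε1, hε2⟩ : ∃ ε : ℝ, 0 < ε ∧ ε * K ≤ 1 ∧ ε * D ≤ V / 4 := by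
    refine ⟨min (K + 1)⁻¹ (V / 4 / (D + 1)), by positivity, ?_, ?_⟩
    · calc min (K + 1)⁻¹ (V / 4 / (D + 1)) * K ≤ (K + 1)⁻¹ * (K + 1) :=
            mul_le_mul (min_le_left _ _) (by linarith) hK0 (by positivity)
        _ = 1 := inv_mul_cancel₀ (by positivity)
    · calc min (K + 1)⁻¹ (V / 4 / (D + 1)) * D ≤ V / 4 / (D + 1) * (D + 1) :=
            mul_le_mul (min_le_right _ _) (by linarith) hD0 (by positivity)
        _ = V / 4 := div_mul_cancel₀ _ (by positivity)
  have hlim : Tendsto (fun n : ℕ => T * (M * K) * (T / n)) atTop (𝓝 0) := by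
    simpa using (tendsto_const_div_atTop_nhds_zero_nat T).const_mul (T * (M * K))
  obtain ⟨N, hN⟩ := eventually_atTop.1 (hlim.eventually (gt_mem_nhds (by positivity : 0 < V / 4)))
  refine ⟨ε * (V / 2), c, N, by positivity, fun n hn _ => ?_⟩
  obtain ⟨Q, hQ0, hQ1, hQ2⟩ := exists_polygonAction_le (n := n) hT hM0 hM hu hK hu0
    (fun t => (sub_add_cancel (A t c) μ).symm) hε0.le hε1
  refine ⟨Q, hQ0, hQ1, hQ2.trans ?_⟩
  have h1 := hN n hn
  calc -ε * V + ε * T * (ε * K ^ 2 + M * K * (T / n + ε * K * T))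
      = ε * (-V + ε * D + T * (M * K) * (T / n)) := by rw [hD]; ring
    _ ≤ ε * -(V / 2) := mul_le_mul_of_nonneg_left (by linarith) hε0.le
    _ = _ := by ring

end DiscreteOrbits

/-! ### Minimizing polygons as discrete orbits with uniform bounds. -/

section ExistenceOfDiscreteOrbits

open Filter

/-- Periodic orbits of the discretized Lorentz force equation with `n` time steps per period,
positions `X` and momenta `P`. -/
structure IsDiscreteOrbit (T : ℝ) (A : ℝ → E3 → E3) (n : ℕ) (X P : ℤ → E3) : Prop where
  periodic : Function.Periodic X n
  position_step : ∀ i, X (i + 1) - X i = (T / n) • velOfMom (P i)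
  momentum_step : ∀ i, P (i + 1) - P i =
    (T / n) • ContinuousLinearMap.adjoint (fderiv ℝ (A ((i + 1 : ℤ) * (T / n))) (X (i + 1)))
        (velOfMom (P (i + 1))) -
      (A ((i + 1 : ℤ) * (T / n)) (X (i + 1)) - A (i * (T / n)) (X i))

variable {T : ℝ} {A : ℝ → E3 → E3}

/-- Large momenta of a closed polygon would all point to the same side. -/
lemma norm_momentum_le_of_sum_eq_zero {E : Type*} [NormedAddCommGroup E] [InnerProductSpace ℝ E]
    {n : ℕ} [NeZero n] {p : ZMod n → E} {D : ℝ} (hsum : ∑ k, velOfMom (p k) = 0)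
    (hstep : ∀ k, ‖p (k + 1) - p k‖ ≤ D) (k : ZMod n) : ‖p k‖ ≤ n * D := by
  by_contra! hk
  have hclose (j : ZMod n) : ‖p j - p k‖ ≤ n * D := by
    -- The polygon estimate is applied to the momenta, with the origin of `ZMod n` moved to `k`.
    have h1 := norm_sub_zero_le_of_step_le (Q := fun i => p (i + k)) (h := D)
      (fun i => by simpa only [add_right_comm] using hstep (i + k)) (j - k)
    simpa using h1
  have hpk : 0 < ‖p k‖ := ((norm_nonneg _).trans (hclose k)).trans_lt hk
  have hpos (j : ZMod n) : 0 < inner ℝ (velOfMom (p j)) (p k) := by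
    refine inner_velOfMom_pos ?_
    have h2 : inner ℝ (p j) (p k) = inner ℝ (p j - p k) (p k) + ‖p k‖ ^ 2 := by
      rw [inner_sub_left, real_inner_self_eq_norm_sq]; ring
    have h3 := (abs_le.1 (abs_real_inner_le_norm (p j - p k) (p k))).1
    have h4 := hclose j
    nlinarith
  have h5 : 0 < ∑ j, inner ℝ (velOfMom (p j)) (p k) :=
    Finset.sum_pos (fun j _ => hpos j) Finset.univ_nonempty
  rw [← sum_inner, hsum, inner_zero_left] at h5
  exact h5.false

lemma gridPotential_intCast {n : ℕ} [NeZero n]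
    (hper : ∀ (t : ℝ) (x : E3), A (t + T) x = A t x) (i : ℤ) :
    gridPotential T A n (i : ZMod n) = A (i * (T / n)) := by
  have hn : (n : ℝ) ≠ 0 := Nat.cast_ne_zero.2 (NeZero.ne n)
  have hA : Function.Periodic A T := fun t => funext fun x => hper t x
  have h1 : (((i : ZMod n).val : ℤ) : ℝ) = ((i % n : ℤ) : ℝ) := by rw [ZMod.val_intCast]
  have h2 : (i : ℝ) = (i % n : ℤ) + n * (i / n : ℤ) := by exact_mod_cast (Int.emod_add_mul_ediv i n).symm
  have h3 : (i : ℝ) * (T / n) = (i % n : ℤ) * (T / n) + (i / n : ℤ) * T := by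
    conv_lhs => rw [h2]
    field_simp
  rw [h3, hA.int_mul (i / n), gridPotential, ← h1, Int.cast_natCast]

/-- All bounds are independent of `n`: those from above give compactness in the limit, while `δ ≤ ‖P
i‖` for one `i` in a period keeps the limit from being constant. -/
lemma exists_isDiscreteOrbit (hT : 0 < T) {M : ℝ} (hM0 : 0 ≤ M)
    (hdiff : ∀ t, Differentiable ℝ (A t))
    (hM : ∀ t s x y, ‖A t x - A s y‖ ≤ M * (|t - s| + ‖x - y‖))
    (hM' : ∀ t x v, ‖ContinuousLinearMap.adjoint (fderiv ℝ (A t) x) v‖ ≤ M * ‖v‖)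
    (hfar : ∀ η : ℝ, 0 < η → ∃ R : ℝ, ∀ c : E3, R ≤ ‖c‖ → ∀ t x, ‖x - c‖ ≤ T →
      ‖A t x - A 0 c‖ ≤ η * (|t| + ‖x - c‖))
    (hper : ∀ (t : ℝ) (x : E3), A (t + T) x = A t x)
    (hnonaut : ∃ (t : ℝ) (x : E3), timeDeriv A t x ≠ 0) :
    ∃ (R δ : ℝ) (N : ℕ), 0 < δ ∧ ∀ n : ℕ, N ≤ n → n ≠ 0 → ∃ X P : ℤ → E3,
      IsDiscreteOrbit T A n X P ∧ (∀ i, ‖X i‖ ≤ R) ∧ (∀ i, ‖P i‖ ≤ 3 * M * T) ∧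
        ∃ i : ℤ, 0 ≤ i ∧ i ≤ n ∧ δ ≤ ‖P i‖ := by
  obtain ⟨δ, c, N, hδ, htest⟩ := exists_polygonAction_le_neg hT hM0 hM hper hnonaut
  -- With this rate the action of a polygon starting outside radius `R₀` is at least `-δ / 2`, which
  -- excludes the boundary for minimizers.
  obtain ⟨R₀, hR₀⟩ := hfar (δ / (4 * T ^ 2)) (by positivity)
  set R := max R₀ ‖c‖ with hR
  -- Chosen so that `2 * M * T ^ 2 * δ' < δ`: if all momenta were below `δ'`, the action would
  -- exceed `-δ`.
  set δ' := δ / (2 * M * T ^ 2 + 1) / 2 with hδ'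
  have hδ'0 : 0 < δ' := by positivity
  refine ⟨R + T, δ', N, hδ'0, fun n hNn hn0 => ?_⟩
  have : NeZero n := ⟨hn0⟩
  have hn : (0 : ℝ) < n := Nat.cast_pos.2 (NeZero.pos n)
  have hh : 0 < T / n := by positivity
  have hnh : n * (T / n) = T := mul_div_cancel₀ T hn.ne'
  set h := T / n with hh_def
  obtain ⟨Q₀, hQ₀0, hQ₀1, hQ₀2⟩ := htest n hNn
  set a := gridPotential T A n with ha_def
  have ha (k : ZMod n) : Differentiable ℝ (a k) := hdiff _
  have htime (k : ZMod n) : |(k.val : ℝ) * h| ≤ T := by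
    rw [abs_of_nonneg (by positivity), ← hnh]
    exact mul_le_mul_of_nonneg_right (by exact_mod_cast (ZMod.val_lt k).le) hh.le
  have hQ₀mem : Q₀ ∈ causalPolygons n E3 h R := ⟨hQ₀0 ▸ le_max_right _ _, hQ₀1⟩
  obtain ⟨Q, hQ, hmin⟩ := (isCompact_causalPolygons (n := n) (E := E3) h R).exists_isMinOn
    ⟨Q₀, hQ₀mem⟩ (continuous_polygonAction h fun k => (ha k).continuous).continuousOn
  have hval : polygonAction h a Q ≤ -δ := (hmin hQ₀mem).trans hQ₀2
  have hdist (k : ZMod n) : ‖Q k - Q 0‖ ≤ T := by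
    have := norm_sub_zero_le_of_step_le hQ.2 k
    rwa [hnh] at this
  have hQR : ‖Q 0‖ < R := by
    by_contra! h1
    have h2 := neg_le_polygonAction hh.le a Q (A 0 (Q 0)) (B := δ / (4 * T ^ 2) * (T + T)) (D := h)
      (fun k => (hR₀ (Q 0) ((le_max_left _ _).trans h1) _ _ (hdist k)).trans
        (mul_le_mul_of_nonneg_left (add_le_add (htime k) (hdist k)) (by positivity))) hQ.2
    have h3 : (n : ℝ) * (δ / (4 * T ^ 2) * (T + T) * h) = δ / 2 := by
      rw [hh_def]; field_simp; ring
    rw [h3] at h2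
    linarith
  have hlt := step_lt_of_isMinOn hh ha hQ hmin
  set v : ZMod n → E3 := fun k => h⁻¹ • (Q (k + 1) - Q k) with hv
  have hQv (k : ZMod n) : Q (k + 1) - Q k = h • v k := by rw [hv, smul_inv_smul₀ hh.ne']
  have hv1 (k : ZMod n) : ‖v k‖ < 1 := by
    rw [hv, norm_smul, norm_inv, Real.norm_of_nonneg hh.le, inv_mul_lt_one₀ hh]
    exact hlt k
  set p : ZMod n → E3 := fun k => momOfVel (v k) with hp
  have hpv (k : ZMod n) : velOfMom (p k) = v k := velOfMom_momOfVel (hv1 k)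
  have hsum : ∑ k, velOfMom (p k) = 0 := by
    simp_rw [hpv, hv, ← Finset.smul_sum, sum_shift_sub, smul_zero]
  have horbit : IsDiscreteOrbit T A n (fun i => Q i) (fun i => p i) := by
    refine ⟨fun i => by simp, fun i => ?_, fun i => ?_⟩
    · rw [hpv, ← hQv]; push_cast; rfl
    · have h1 := momOfVel_succ_sub_of_isMinOn hh ha hQ hQR hmin (i : ZMod n)
      rw [← gridPotential_intCast hper, ← gridPotential_intCast hper, ← map_smul, hpv, ← hQv]
      push_cast
      exact h1
  have hpstep (k : ZMod n) : ‖p (k + 1) - p k‖ ≤ 3 * M * h := by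
    obtain ⟨i, rfl⟩ := ZMod.intCast_surjective k
    have h1 := horbit.momentum_step i
    push_cast at h1
    rw [h1, ← map_smul]
    refine (norm_sub_le _ _).trans ?_
    have h2 := hM' ((i + 1) * h) (Q (i + 1)) (h • velOfMom (p (i + 1)))
    have h3 := hM ((i + 1) * h) (i * h) (Q (i + 1)) (Q i)
    rw [hpv, ← hQv] at h2
    have h4 := mul_le_mul_of_nonneg_left (hQ.2 (i + 1)) hM0
    have h5 := mul_le_mul_of_nonneg_left (hQ.2 i) hM0
    have h6 : |((i : ℝ) + 1) * h - i * h| = h := by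
      rw [add_mul, add_sub_cancel_left, one_mul, abs_of_pos hh]
    rw [h6] at h3
    rw [hpv, ← hQv]
    linarith
  refine ⟨fun i => Q i, fun i => p i, horbit, fun i => ?_, fun i => ?_, ?_⟩
  · have h1 := norm_le_norm_add_norm_sub' (Q i) (Q 0)
    have h2 := hdist i
    linarith
  · refine (norm_momentum_le_of_sum_eq_zero hsum hpstep _).trans_eq ?_
    rw [hh_def]; field_simp
  · by_contra! hsmall
    have hv_small (k : ZMod n) : ‖Q (k + 1) - Q k‖ ≤ h * δ' := by
      have h1 := hsmall k.val (by positivity) (by exact_mod_cast (ZMod.val_lt k).le)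
      rw [Int.cast_natCast, ZMod.natCast_zmod_val] at h1
      rw [hQv, norm_smul, Real.norm_of_nonneg hh.le]
      exact mul_le_mul_of_nonneg_left ((norm_le_norm_momOfVel (hv1 k)).trans h1.le) hh.le
    have h2 := neg_le_polygonAction hh.le a Q (A 0 (Q 0)) (B := M * (T + T)) (D := h * δ')
      (fun k => (hM _ _ _ _).trans (mul_le_mul_of_nonneg_left
        (add_le_add (by simpa using htime k) (hdist k)) hM0)) hv_small
    have h3 : (n : ℝ) * (M * (T + T) * (h * δ')) = 2 * M * T ^ 2 * δ' := by
      rw [hh_def]; field_simp; ring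
    have h4 : (2 * M * T ^ 2 + 1) * δ' = δ / 2 := by
      rw [hδ']; field_simp
    rw [h3] at h2
    linarith

end ExistenceOfDiscreteOrbits

/-! ### Passage from discrete orbits to solutions. -/

section PeriodicSolutions

open Filter

/-- Strict differentiability is what allows both endpoints of the difference quotient to move. -/
lemma HasStrictFDerivAt.tendsto_inv_smul_sub {ι E F : Type*} [NormedAddCommGroup E]
    [NormedSpace ℝ E] [NormedAddCommGroup F] [NormedSpace ℝ F] {G : E → F} {G' : E →L[ℝ] F}
    {z v : E} (hG : HasStrictFDerivAt G G' z) {l : Filter ι} {a b : ι → E} {h : ι → ℝ}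
    (ha : Tendsto a l (𝓝 z)) (hb : Tendsto b l (𝓝 z))
    (hab : Tendsto (fun i => (h i)⁻¹ • (b i - a i)) l (𝓝 v)) :
    Tendsto (fun i => (h i)⁻¹ • (G (b i) - G (a i))) l (𝓝 (G' v)) := by
  have h1 := hG.isLittleO.comp_tendsto (hb.prodMk_nhds ha)
  have h2 := ((Asymptotics.isBigO_refl (fun i => (h i)⁻¹) l).smul_isLittleO h1).trans_isBigO
    (hab.isBigO_one ℝ)
  have h3 := ((Asymptotics.isLittleO_one_iff ℝ).1 h2).add ((G'.continuous.tendsto v).comp hab)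
  rw [zero_add] at h3
  refine h3.congr fun i => ?_
  simp only [Function.comp_apply, map_smul, smul_sub, map_sub]
  abel

/-- One fixed ultrafilter provides limits at all real times at once, in place of a diagonal
subsequence. -/
lemma Ultrafilter.exists_tendsto_of_norm_le {E : Type*} [NormedAddCommGroup E] [ProperSpace E]
    (U : Ultrafilter ℕ) {x : ℕ → E} {R : ℝ} (hx : ∀ n, ‖x n‖ ≤ R) :
    ∃ y, ‖y‖ ≤ R ∧ Tendsto x U (𝓝 y) := by
  obtain ⟨y, hy, hU⟩ := (isCompact_closedBall (0 : E) R).ultrafilter_le_nhds (U.map x)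
    (le_principal_iff.2 (mem_map.2 (univ_mem' fun n => mem_closedBall_zero_iff.2 (hx n))))
  exact ⟨y, mem_closedBall_zero_iff.1 hy, hU⟩

variable {T : ℝ} {A : ℝ → E3 → E3}

/-- A curve of momentum `p` that satisfies the Hamiltonian form of the Lorentz force equation is a
solution. -/
lemma isPeriodicLFESolution_of_hasDerivAt (hA : ContDiff ℝ 1 (fun p : ℝ × E3 => A p.1 p.2))
    {q p : ℝ → E3} {b : ℝ} (hper : Function.Periodic q T) (hb : ∀ t, ‖p t‖ ≤ b)
    (hq : ∀ t, HasDerivAt q (velOfMom (p t)) t)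
    (hp : ∀ t, HasDerivAt p (ContinuousLinearMap.adjoint (fderiv ℝ (A t) (q t)) (velOfMom (p t)) -
      fderiv ℝ (fun p : ℝ × E3 => A p.1 p.2) (t, q t) (1, velOfMom (p t))) t) :
    IsPeriodicLFESolution T A q := by
  have hdq : deriv q = fun t => velOfMom (p t) := funext fun t => (hq t).deriv
  have hmom : relMomentum q = p := by
    funext t
    have h1 := momOfVel_velOfMom (p t)
    rwa [← (hq t).deriv] at h1
  have hpcont : Continuous p := continuous_iff_continuousAt.2 fun t => (hp t).continuousAt
  have hqcont : Continuous q := continuous_iff_continuousAt.2 fun t => (hq t).continuousAt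
  have hvcont : Continuous fun t => velOfMom (p t) :=
    (contDiff_velOfMom (n := 0)).continuous.comp hpcont
  have hGcont : Continuous fun t => fderiv ℝ (fun p : ℝ × E3 => A p.1 p.2) (t, q t) :=
    (hA.continuous_fderiv one_ne_zero).comp (by fun_prop)
  have hdp : ContDiff ℝ 1 p := by
    refine contDiff_one_iff_deriv.2 ⟨fun t => (hp t).differentiableAt, ?_⟩
    rw [show deriv p = _ from funext fun t => (hp t).deriv]
    have h1 : Continuous fun t => ContinuousLinearMap.adjoint (fderiv ℝ (A t) (q t)) := by
      refine (LinearIsometryEquiv.continuous _).comp ?_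
      simp only [fun t => (hasFDerivAt_potential hA t (q t)).fderiv]
      fun_prop
    exact (h1.clm_apply hvcont).sub (hGcont.clm_apply (by fun_prop))
  refine ⟨?_, hper, ?_, fun t => ?_⟩
  · refine (contDiff_succ_iff_deriv (n := 1)).2
      ⟨fun t => (hq t).differentiableAt, fun h => by simp at h, ?_⟩
    rw [hdq]
    exact contDiff_velOfMom.comp hdp
  · have h1 : velocitySup q ≤ ENNReal.ofReal (b / Real.sqrt (1 + b ^ 2)) := by
      refine iSup_le fun t => ?_
      rw [← ofReal_norm, hdq]
      exact ENNReal.ofReal_le_ofReal (norm_velOfMom_le_of_norm_le (hb t))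
    exact h1.trans_lt (ENNReal.ofReal_lt_one.2 (div_sqrt_one_add_sq_lt_one b))
  · rw [lorentzForce_eq hA, hmom, (hq t).deriv]
    exact hp t

/-- Limits of discrete orbits solve the Lorentz force equation. -/
lemma exists_isPeriodicLFESolution_of_isDiscreteOrbit (hT : 0 < T)
    (hA : ContDiff ℝ 1 (fun p : ℝ × E3 => A p.1 p.2)) {M : ℝ} (hM0 : 0 ≤ M)
    (hM : ∀ t s x y, ‖A t x - A s y‖ ≤ M * (|t - s| + ‖x - y‖))
    (hM' : ∀ t x v, ‖ContinuousLinearMap.adjoint (fderiv ℝ (A t) x) v‖ ≤ M * ‖v‖)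
    {R b δ : ℝ} (hδ : 0 < δ) {N : ℕ}
    (horbit : ∀ n : ℕ, N ≤ n → n ≠ 0 → ∃ X P : ℤ → E3,
      IsDiscreteOrbit T A n X P ∧ (∀ i, ‖X i‖ ≤ R) ∧ (∀ i, ‖P i‖ ≤ b) ∧
        ∃ i : ℤ, 0 ≤ i ∧ i ≤ n ∧ δ ≤ ‖P i‖) :
    ∃ q : ℝ → E3, IsPeriodicLFESolution T A q ∧ ¬ ∃ c : E3, ∀ t : ℝ, q t = c := by
  -- The number of steps is `m + N + 1`, which is both at least `N` and nonzero.
  choose X P hXP hXR hPb i hi0 hin hiδ using fun m : ℕ =>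
    horbit (m + N + 1) (by omega) (by omega)
  set h : ℕ → ℝ := fun m => T / (m + N + 1 : ℕ) with hh_def
  have hpos (m : ℕ) : 0 < h m := by positivity
  have hpos' (U : Filter ℕ) : ∀ᶠ m in U, 0 < h m := Eventually.of_forall hpos
  set U : Ultrafilter ℕ := hyperfilter ℕ
  have h0 : Tendsto h U (𝓝 0) := by
    have h1 := (tendsto_const_div_atTop_nhds_zero_nat T).comp (tendsto_add_atTop_nat (N + 1))
    exact h1.mono_left Nat.hyperfilter_le_atTop
  have hXstep (m : ℕ) (j : ℤ) : ‖X m (j + 1) - X m j‖ ≤ 1 * h m := by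
    rw [(hXP m).position_step, norm_smul, Real.norm_of_nonneg (hpos m).le, mul_comm]
    exact mul_le_mul_of_nonneg_right (norm_velOfMom_lt_one _).le (hpos m).le
  have hPstep (m : ℕ) (j : ℤ) : ‖P m (j + 1) - P m j‖ ≤ 3 * M * h m := by
    rw [(hXP m).momentum_step, ← map_smul, ← (hXP m).position_step]
    refine (norm_sub_le _ _).trans ?_
    have h2 := hM' ((j + 1 : ℤ) * h m) (X m (j + 1)) (X m (j + 1 + 1) - X m (j + 1))
    have h3 := hM ((j + 1 : ℤ) * h m) (j * h m) (X m (j + 1)) (X m j)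
    have h4 := mul_le_mul_of_nonneg_left (hXstep m (j + 1)) hM0
    have h5 := mul_le_mul_of_nonneg_left (hXstep m j) hM0
    have h6 : |((j + 1 : ℤ) : ℝ) * h m - j * h m| = h m := by
      push_cast
      rw [add_mul, add_sub_cancel_left, one_mul, abs_of_pos (hpos m)]
    rw [h6] at h3
    linarith
  choose q hqR hq using fun t : ℝ =>
    U.exists_tendsto_of_norm_le (x := fun m => X m ⌊t / h m⌋) fun m => hXR m _
  choose p hpb hp using fun t : ℝ =>
    U.exists_tendsto_of_norm_le (x := fun m => P m ⌊t / h m⌋) fun m => hPb m _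
  have hXnear (s : ℝ) : Tendsto (fun z : ℕ × ℤ => X z.1 z.2) (nearTime U h s) (𝓝 (q s)) :=
    tendsto_nearTime_of_step_le (hpos' _) h0 (Eventually.of_forall hXstep) (hq s)
  have hPnear (s : ℝ) : Tendsto (fun z : ℕ × ℤ => P z.1 z.2) (nearTime U h s) (𝓝 (p s)) :=
    tendsto_nearTime_of_step_le (hpos' _) h0 (Eventually.of_forall hPstep) (hp s)
  have hVnear (s : ℝ) : Tendsto (fun z : ℕ × ℤ => velOfMom (P z.1 z.2)) (nearTime U h s)
      (𝓝 (velOfMom (p s))) :=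
    ((contDiff_velOfMom (n := 0)).continuous.tendsto _).comp (hPnear s)
  have hXquot (s : ℝ) : Tendsto (fun z : ℕ × ℤ => (h z.1)⁻¹ • (X z.1 (z.2 + 1) - X z.1 z.2))
      (nearTime U h s) (𝓝 (velOfMom (p s))) := by
    refine (hVnear s).congr fun z => ?_
    rw [(hXP z.1).position_step, inv_smul_smul₀ (hpos z.1).ne']
  have hderq (s : ℝ) : HasDerivAt q (velOfMom (p s)) s :=
    hasDerivAt_of_tendsto_nearTime (hpos' _) h0 hq (hXquot s)
  have hderp (s : ℝ) : HasDerivAt p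
      (ContinuousLinearMap.adjoint (fderiv ℝ (A s) (q s)) (velOfMom (p s)) -
        fderiv ℝ (fun p : ℝ × E3 => A p.1 p.2) (s, q s) (1, velOfMom (p s))) s := by
    refine hasDerivAt_of_tendsto_nearTime (hpos' _) h0 hp ?_
    have hz : Tendsto (fun z : ℕ × ℤ => ((z.2 : ℝ) * h z.1, X z.1 z.2)) (nearTime U h s)
        (𝓝 (s, q s)) := tendsto_time_nearTime.prodMk_nhds (hXnear s)
    have hz' := hz.comp (tendsto_succ_nearTime h0)
    have hadj : Tendsto (fun z : ℕ × ℤ => ContinuousLinearMap.adjoint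
        (fderiv ℝ (A ((z.2 : ℝ) * h z.1)) (X z.1 z.2))) (nearTime U h s)
        (𝓝 (ContinuousLinearMap.adjoint (fderiv ℝ (A s) (q s)))) := by
      refine ((LinearIsometryEquiv.continuous _).tendsto _).comp ?_
      simp only [fun t x => (hasFDerivAt_potential hA t x).fderiv]
      have hc : Continuous fun z : ℝ × E3 => (fderiv ℝ (fun p : ℝ × E3 => A p.1 p.2) z).comp
          (ContinuousLinearMap.inr ℝ ℝ E3) :=
        (hA.continuous_fderiv one_ne_zero).clm_comp continuous_const
      exact (hc.tendsto (s, q s)).comp hz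
    have hfirst := (((isBoundedBilinearMap_apply (𝕜 := ℝ)).continuous.tendsto
      (ContinuousLinearMap.adjoint (fderiv ℝ (A s) (q s)), velOfMom (p s))).comp
        (hadj.prodMk_nhds (hVnear s))).comp (tendsto_succ_nearTime h0)
    -- Increments of `A` between consecutive grid points become its total derivative along the
    -- curve.
    have hsecond := (hA.contDiffAt (x := (s, q s))).hasStrictFDerivAt one_ne_zero
      |>.tendsto_inv_smul_sub (v := (1, velOfMom (p s))) (h := fun z : ℕ × ℤ => h z.1) hz hz' (by
        refine (tendsto_const_nhds.prodMk_nhds (hXquot s)).congr fun z => ?_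
        simp only [Function.comp_apply, Prod.mk_sub_mk, Prod.smul_mk, Prod.mk.injEq, and_true,
          smul_eq_mul]
        push_cast
        rw [add_mul, add_sub_cancel_left, one_mul, inv_mul_cancel₀ (hpos z.1).ne'])
    refine (hfirst.sub hsecond).congr fun z => ?_
    rw [(hXP z.1).momentum_step]
    change _ = (h z.1)⁻¹ • (h z.1 • _ - _)
    rw [smul_sub _ (h z.1 • _), inv_smul_smul₀ (hpos z.1).ne']
    rfl
  have hqper : Function.Periodic q T := fun t => by
    refine tendsto_nhds_unique (hq (t + T)) ((hq t).congr fun m => ?_)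
    -- `T / h m` is exactly the number of steps, so the floor shifts by a full period of `X m`.
    have h1 : (t + T) / h m = t / h m + ((m + N + 1 : ℕ) : ℤ) := by
      rw [add_div]
      congr 1
      simp only [hh_def]
      rw [div_div_cancel₀ hT.ne', Int.cast_natCast]
    simp only [h1, Int.floor_add_intCast]
    exact ((hXP m).periodic _).symm
  refine ⟨q, isPeriodicLFESolution_of_hasDerivAt hA hqper hpb hderq hderp, ?_⟩
  rintro ⟨c, hc⟩
  have hp0 (t : ℝ) : p t = 0 := by
    have h1 := (hderq t).unique ((funext hc : q = fun _ => c) ▸ hasDerivAt_const t c)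
    rw [← momOfVel_velOfMom (p t), h1, momOfVel, smul_zero]
  -- The times `i m * h m` of the large momenta lie in `[0, T]`; at their limit `s` the momentum has
  -- norm at least `δ`, whereas a constant curve has zero momentum.
  obtain ⟨s, -, hs⟩ := U.exists_tendsto_of_norm_le (x := fun m => (i m : ℝ) * h m) (R := T)
    fun m => by
      have h1 : (0 : ℝ) ≤ i m := by exact_mod_cast hi0 m
      have h2 : (i m : ℝ) ≤ (m + N + 1 : ℕ) := by exact_mod_cast hin m
      rw [Real.norm_of_nonneg (mul_nonneg h1 (hpos m).le)]
      refine (mul_le_mul_of_nonneg_right h2 (hpos m).le).trans_eq (mul_div_cancel₀ T ?_)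
      positivity
  have hlim : Tendsto (fun m => P m (i m)) U (𝓝 (p s)) :=
    (hPnear s).comp (tendsto_nearTime_iff.2 ⟨tendsto_id, hs⟩ :
      Tendsto (fun m => (m, i m)) U (nearTime U h s))
  have h3 := ge_of_tendsto hlim.norm (Eventually.of_forall hiδ)
  rw [hp0, norm_zero] at h3
  exact hδ.not_ge h3

end PeriodicSolutions

end

theorem mainTheorem1 (T : ℝ) (hT : 0 < T) (A : ℝ → E3 → E3)
    (hA : ContDiff ℝ 1 (fun p : ℝ × E3 => A p.1 p.2))
    (hper : ∀ (t : ℝ) (x : E3), A (t + T) x = A t x)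
    (hnonaut : ∃ (t : ℝ) (x : E3), timeDeriv A t x ≠ 0)
    (hdecay : TendstoUniformly (fun (x : E3) (t : ℝ) => ‖timeDeriv A t x‖ + ‖fderiv ℝ (A t) x‖)
      (fun _ : ℝ => (0 : ℝ)) (Bornology.cobounded E3)) :
    ∃ ρ : ℝ, 0 < ρ ∧ ρ < 1 ∧
      (∃ q : ℝ → E3, IsPeriodicLFESolution T A q ∧ ¬ ∃ c : E3, ∀ t : ℝ, q t = c) ∧
      (∀ q : ℝ → E3, IsPeriodicLFESolution T A q → velocitySup q < ENNReal.ofReal ρ) := by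
  obtain ⟨M, hM0, hM⟩ := exists_norm_fderiv_uncurry_le hT hA hper hdecay
  have hb : 0 < 3 * M * T := by positivity
  -- The speed bound is not strict, so `ρ` is taken strictly above it.
  obtain ⟨ρ, hρ, hρ1⟩ := exists_between (div_sqrt_one_add_sq_lt_one (3 * M * T))
  have hρ0 : 0 < ρ := lt_trans (by positivity) hρ
  have hlip (t s : ℝ) (x y : E3) : ‖A t x - A s y‖ ≤ M * (|t - s| + ‖x - y‖) :=
    norm_potential_sub_le hA (c := x) (r := ‖y - x‖) (fun _ _ _ => hM _) hM0.le t s (by simp) le_rfl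
  have hadj := norm_adjoint_fderiv_apply_le hA hM
  have hfar (η : ℝ) (hη : 0 < η) : ∃ R : ℝ, ∀ c : E3, R ≤ ‖c‖ → ∀ t x, ‖x - c‖ ≤ T →
      ‖A t x - A 0 c‖ ≤ η * (|t| + ‖x - c‖) := by
    obtain ⟨R, hR⟩ := exists_norm_fderiv_uncurry_le_of_decay hA hdecay hη
    -- The ball of radius `T` about `c` then avoids the ball of radius `R` about the origin.
    refine ⟨R + T, fun c hc t x hx => ?_⟩
    have h1 := norm_potential_sub_le hA (c := c) (r := T) (fun t y hy => hR t y (by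
      have h2 := norm_le_norm_add_norm_sub y c
      linarith)) hη.le t 0 (y := c) hx (by simpa using hT.le)
    simpa using h1
  obtain ⟨R, δ, N, hδ, horbit⟩ := exists_isDiscreteOrbit hT hM0.le
    (fun t x => (hasFDerivAt_potential hA t x).differentiableAt) hlip hadj hfar hper hnonaut
  refine ⟨ρ, hρ0, hρ1,
    exists_isPeriodicLFESolution_of_isDiscreteOrbit hT hA hM0.le hlip hadj hδ horbit,
    fun q hq => (hq.velocitySup_le hT hA hM).trans_lt ?_⟩
  exact (ENNReal.ofReal_lt_ofReal_iff hρ0).2 hρ
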